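/- **Setting.** Let $\Gamma\subset\mathbb R\times\mathbb R$ be a lattice (a discrete cocompact subgroup) which projects injectively to the first and densely to the second factor, and let $W\subset\mathbb R$ be a bounded interval of positive length. Equip the torus $\Omega=(\mathbb R\times\mathbb R)/\Gamma$ with its Haar probability measure $\mathbb P$. The *cut-and-project process* $p=p(\mathbb R,\mathbb R,\Gamma,W)$ is the random measure $$p_{[g,h]}=\sum_{x\in\Lambda_{[g,h]}}\delta_x,\qquad \Lambda_{[g,h]}=\mathrm{pr}_1\bigl(\Gamma\cap(\mathbb R\times(W-h))\bigr)+g\qquad([g,h]\in\Omega).$$ Let $M^1=\mathbb E[p_\omega]=i\cdot dx$ (where $i$ is the intensity) and $M^2=\mathbb E[p_\omega\otimes p_\omega]$ be its first two moment measures, let $\eta^+(f)=\int f(x-y)\,1_{[0,1)}(y)\,dM^2(x,y)$ be its autocorrelation and $\eta=\eta^+-i^2\,dx$ its centered autocorrelation. The *centered diffraction* $\widehat\eta$ of $p$ is the Fourier transform of $\eta$, i.e. the Radon measure on $\mathbb R$ with $\int|\widehat f|^2\,d\widehat\eta=\eta(f*f^*)$ for all continuous compactly supported $f:\mathbb R\to\mathbb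 C$, where $\widehat f(\xi)=\int f(x)e^{-2\pi i x\xi}\,dx$ and $f^*(x)=\overline{f(-x)}$. The process $p$ is *hyperuniform* if $\widehat\eta((-t,t))/t\to0$ as $t\to0^+$. For irrational $a>0$ let $$\Gamma_a=\frac1{2a}\begin{pmatrix}1&-a\\1&a\end{pmatrix}\mathbb Z^2,$$ which is a lattice as above, and for $b>0$ let $\widehat\eta_{a,b}$ be the centered diffraction of $p(\mathbb R,\mathbb R,\Gamma_a,[-b,b])$. For $\theta\in\mathbb R$ write $\{\theta\}_{\mathbb Z}=\min_{n\in\mathbb Z}|\theta+n|$. **Theorem.** 1. Let $a>0$ be irrational, let $\gamma>2$, and let $(m_k)$ be a sequence of positive integers with $m_k\to\infty$ and $\{m_ka\}_{\mathbb Z}\le m_k^{-\gamma}$ for all $k$. Put $u_k=2m_k^{-\gamma}$. Then for Lebesgue-almost every $b\in(0,\frac1{2a}]$ there is a subsequence $(k_j)$ such that for all $\delta>\frac2\gamma$ $$\lim_{j\to\infty}\frac{\widehat\eta_{a,b}([-u_{k_j},u_{k_j}])}{u_{k_j}^{\delta}}=\infty.$$ 2. If $a>0$ is a Liouville number, then for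 Lebesgue-almost every $b\in(0,\frac1{2a}]$ and for all $\delta>0$ $$\varlimsup_{u\to0^+}\frac{\widehat\eta_{a,b}([-u,u])}{u^{\delta}}=\infty.$$ 3. For every $\alpha>0$ there is a cut-and-project process $p(\mathbb R,\mathbb R,\Gamma,W)$, with $W$ a bounded closed interval of positive length, whose centered diffraction satisfies $$\varlimsup_{\varepsilon\to0^+}\frac{\widehat\eta((-\varepsilon,\varepsilon))}{\varepsilon^{\alpha}}=\infty.$$ 4. In particular, there is a cut-and-project process $p(\mathbb R,\mathbb R,\Gamma,W)$, with $W$ a bounded closed interval of positive length, which is not hyperuniform. -/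

import Mathlib

open MeasureTheory Filter Topology FourierTransform ComplexConjugate

noncomputable section

namespace CutProject

/-! ### Second-order theory of random measures on the real line

A random measure on `ℝ` is a map `p : Ω → Measure ℝ` on a probability space `(Ω, P)`. -/

section RandomMeasure

variable {Ω : Type*} [MeasurableSpace Ω]

/-- The first moment measure `M¹(A) = 𝔼[p_ω(A)]`. -/
def firstMoment (P : Measure Ω) (p : Ω → Measure ℝ) : Measure ℝ :=
  P.bind p

/-- The second moment measure `M²(B) = 𝔼[(p_ω ⊗ p_ω)(B)]`. -/
def secondMoment (P : Measure Ω) (p : Ω → Measure ℝ) : Measure (ℝ × ℝ) :=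
  P.bind fun ω => (p ω).prod (p ω)

/-- The intensity of an invariant random measure: the constant `i` for which `M¹` is `i` times
Lebesgue measure, that is, the `M¹`-mass of the unit interval. -/
def intensity (P : Measure Ω) (p : Ω → Measure ℝ) : ℝ :=
  (firstMoment P p).real (Set.Ico 0 1)

/-- The autocorrelation measure `η⁺` of an invariant random measure,
`η⁺(f) = ∫ f(x - y) ρ(y) dM²(x, y)`, for the normalized density `ρ = 1_{[0,1)}` (the measure does
not depend on the choice of `ρ`). -/
def autocorrelation (P : Measure Ω) (p : Ω → Measure ℝ) : Measure ℝ :=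
  ((secondMoment P p).restrict {z | z.2 ∈ Set.Ico (0 : ℝ) 1}).map fun z => z.1 - z.2

/-- The centered autocorrelation `η = η⁺ - i² · Lebesgue`. It is in general a signed measure of
infinite total variation, hence it is recorded through the integrals of test functions. -/
def centeredAutocorrelation (P : Measure Ω) (p : Ω → Measure ℝ) (f : ℝ → ℂ) : ℂ :=
  (∫ x, f x ∂(autocorrelation P p)) - (intensity P p : ℂ) ^ 2 * ∫ x, f x

/-- The convolution `f * f^*`, where `f^*(x) = conj (f (-x))`. -/
def convStar (f : ℝ → ℂ) (x : ℝ) : ℂ :=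
  ∫ t, f t * conj (f (t - x))

/-- `σ` is the Fourier transform of the positive definite (signed) Radon measure `η`: the Radon
measure with `∫ |𝓕 f|² dσ = η(f * f^*)` for all continuous compactly supported `f : ℝ → ℂ`, where
`𝓕 f ξ = ∫ f(x) e^{-2πi x ξ} dx`. -/
structure IsFourierTransform (η : (ℝ → ℂ) → ℂ) (σ : Measure ℝ) : Prop where
  locallyFinite : IsLocallyFiniteMeasure σ
  integrable : ∀ f : ℝ → ℂ, Continuous f → HasCompactSupport f →
    Integrable (fun ξ => ‖𝓕 f ξ‖ ^ 2) σ
  integral_eq : ∀ f : ℝ → ℂ, Continuous f → HasCompactSupport f →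
    ((∫ ξ, ‖𝓕 f ξ‖ ^ 2 ∂σ : ℝ) : ℂ) = η (convStar f)

open Classical in
/-- The centered diffraction of `p`: the Fourier transform of its centered autocorrelation
(and, as a convention, the zero measure if there is no such Fourier transform). -/
def centeredDiffraction (P : Measure Ω) (p : Ω → Measure ℝ) : Measure ℝ :=
  if h : ∃ σ : Measure ℝ, IsFourierTransform (centeredAutocorrelation P p) σ then h.choose else 0

/-- (Spectral) hyperuniformity: the centered diffraction of the ball of radius `t` around `0` is
`o(t)` as `t → 0`. -/
def IsHyperuniform (P : Measure Ω) (p : Ω → Measure ℝ) : Prop :=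
  Tendsto (fun t : ℝ => centeredDiffraction P p (Metric.ball 0 t) / ENNReal.ofReal t)
    (𝓝[>] 0) (𝓝 0)

end RandomMeasure

/-! ### Cut-and-project processes with parameters `(ℝ, ℝ, Γ, W)` -/

/-- `Γ` is a lattice in `ℝ × ℝ` (discrete and cocompact) which projects injectively to the first
and densely to the second factor. -/
structure IsCutProjectLattice (Γ : AddSubgroup (ℝ × ℝ)) : Prop where
  discrete : DiscreteTopology Γ
  cocompact : CompactSpace ((ℝ × ℝ) ⧸ Γ)
  injOn_fst : Set.InjOn Prod.fst (Γ : Set (ℝ × ℝ))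
  dense_snd : Dense (Prod.snd '' (Γ : Set (ℝ × ℝ)))

/-- The cut-and-project set `Λ(ℝ, ℝ, Γ, W) = pr₁(Γ ∩ (ℝ × W))`. -/
def cutProjectSet (Γ : AddSubgroup (ℝ × ℝ)) (W : Set ℝ) : Set ℝ :=
  Prod.fst '' ((Γ : Set (ℝ × ℝ)) ∩ {z | z.2 ∈ W})

/-- The set `Λ(ℝ, ℝ, Γ, W - h) + g`. -/
def translatedSet (Γ : AddSubgroup (ℝ × ℝ)) (W : Set ℝ) (z : ℝ × ℝ) : Set ℝ :=
  (fun x => x + z.1) '' cutProjectSet Γ ((fun w => w - z.2) '' W)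

theorem mem_translatedSet {Γ : AddSubgroup (ℝ × ℝ)} {W : Set ℝ} {z : ℝ × ℝ} {x : ℝ} :
    x ∈ translatedSet Γ W z ↔ ∃ γ ∈ Γ, γ.2 + z.2 ∈ W ∧ γ.1 + z.1 = x := by
  constructor
  · rintro ⟨_, ⟨γ, ⟨hγ, ⟨w, hw, hwγ⟩⟩, rfl⟩, rfl⟩
    refine ⟨γ, hγ, ?_, rfl⟩
    have : γ.2 + z.2 = w := by simp only at hwγ; linarith
    rwa [this]
  · rintro ⟨γ, hγ, hW, rfl⟩
    exact ⟨γ.1, ⟨γ, ⟨hγ, ⟨_, hW, by simp⟩⟩, rfl⟩, rfl⟩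

theorem translatedSet_subset (Γ : AddSubgroup (ℝ × ℝ)) (W : Set ℝ) (y z : ℝ × ℝ)
    (h : -y + z ∈ Γ) : translatedSet Γ W y ⊆ translatedSet Γ W z := by
  intro x hx
  obtain ⟨γ, hγ, hW, rfl⟩ := mem_translatedSet.1 hx
  refine mem_translatedSet.2 ⟨γ - (-y + z), Γ.sub_mem hγ h, ?_, ?_⟩
  · have : (γ - (-y + z)).2 + z.2 = γ.2 + y.2 := by
      simp only [Prod.snd_sub, Prod.snd_add, Prod.snd_neg]; ring
    rwa [this]
  · simp only [Prod.fst_sub, Prod.fst_add, Prod.fst_neg]; ring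

/-- The random set `Λ_ω` on the torus `Ω = (ℝ × ℝ) / Γ`:
`Λ_{[g,h]} = Λ(ℝ, ℝ, Γ, W - h) + g`. -/
def pointSet (Γ : AddSubgroup (ℝ × ℝ)) (W : Set ℝ) (ω : (ℝ × ℝ) ⧸ Γ) : Set ℝ :=
  Quotient.liftOn' ω (translatedSet Γ W) fun y z h => by
    have h' : -y + z ∈ Γ := QuotientAddGroup.leftRel_apply.1 h
    refine Set.Subset.antisymm (translatedSet_subset Γ W y z h')
      (translatedSet_subset Γ W z y ?_)
    have := Γ.neg_mem h'
    rwa [neg_add_rev, neg_neg] at this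

/-- The cut-and-project process `p(ℝ, ℝ, Γ, W)`: it sends `ω` to the sum of the Dirac masses at the
points of `Λ_ω`. -/
def process (Γ : AddSubgroup (ℝ × ℝ)) (W : Set ℝ) (ω : (ℝ × ℝ) ⧸ Γ) : Measure ℝ :=
  Measure.sum fun x : pointSet Γ W ω => Measure.dirac (x : ℝ)

/-- The Haar probability measure on the torus `Ω = (ℝ × ℝ) / Γ`, which is the unique Borel
probability measure on `Ω` that is invariant under translations by the first factor. -/
def torusMeasure (Γ : AddSubgroup (ℝ × ℝ)) (hΓ : IsCutProjectLattice Γ) :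
    Measure ((ℝ × ℝ) ⧸ Γ) :=
  haveI := hΓ.discrete
  haveI := hΓ.cocompact
  haveI : IsClosed (Γ : Set (ℝ × ℝ)) := AddSubgroup.isClosed_of_discrete
  Measure.addHaarMeasure ⊤

/-- The centered diffraction of the cut-and-project process `p(ℝ, ℝ, Γ, W)`. -/
def diffraction (Γ : AddSubgroup (ℝ × ℝ)) (hΓ : IsCutProjectLattice Γ) (W : Set ℝ) :
    Measure ℝ :=
  centeredDiffraction (torusMeasure Γ hΓ) (process Γ W)

/-! ### The lattices `Γ_a` -/

/-- The homomorphism `ℤ² → ℝ²` given by the matrix `(2a)⁻¹ [[1, -a], [1, a]]`. -/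
def latticeHom (a : ℝ) : ℤ × ℤ →+ ℝ × ℝ where
  toFun k := (1 / (2 * a) * (k.1 - a * k.2), 1 / (2 * a) * (k.1 + a * k.2))
  map_zero' := by simp
  map_add' k l := by ext <;> (simp; ring)

/-- The lattice `Γ_a = (2a)⁻¹ [[1, -a], [1, a]] ℤ²`. -/
def lattice (a : ℝ) : AddSubgroup (ℝ × ℝ) := (latticeHom a).range

theorem isCutProjectLattice {a : ℝ} (ha : 0 < a) (hirr : Irrational a) :
    IsCutProjectLattice (lattice a) := by
  have ha' : a ≠ 0 := ha.ne'
  refine ⟨?_, ?_, ?_, ?_⟩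
  · -- the open set `{|a (x + y)| < 1, |y - x| < 1}` meets the lattice in `0` only
    refine discreteTopology_of_isOpen_singleton_zero ?_
    rw [isOpen_induced_iff]
    refine ⟨{z | |a * (z.1 + z.2)| < 1 ∧ |z.2 - z.1| < 1}, ?_, ?_⟩
    · have c1 : Continuous fun z : ℝ × ℝ => |a * (z.1 + z.2)| := by fun_prop
      have c2 : Continuous fun z : ℝ × ℝ => |z.2 - z.1| := by fun_prop
      exact (isOpen_lt c1 continuous_const).inter (isOpen_lt c2 continuous_const)
    · ext ⟨z, k, rfl⟩
      have h1 : a * (((latticeHom a) k).1 + ((latticeHom a) k).2) = (k.1 : ℝ) := by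
        simp only [latticeHom, AddMonoidHom.coe_mk, ZeroHom.coe_mk]; field_simp; ring
      have h2 : ((latticeHom a) k).2 - ((latticeHom a) k).1 = (k.2 : ℝ) := by
        simp only [latticeHom, AddMonoidHom.coe_mk, ZeroHom.coe_mk]; field_simp; ring
      simp only [Set.mem_preimage, Set.mem_ofPred_eq, Set.mem_singleton_iff, h1, h2]
      constructor
      · rintro ⟨h3, h4⟩
        have h5 : k.1 = 0 := Int.abs_lt_one_iff.1 (by exact_mod_cast h3)
        have h6 : k.2 = 0 := Int.abs_lt_one_iff.1 (by exact_mod_cast h4)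
        have : k = 0 := Prod.ext h5 h6
        subst this
        exact Subtype.ext (map_zero _)
      · intro h
        have h0 : (latticeHom a) k = 0 := congrArg Subtype.val h
        rw [h0] at h1 h2
        rw [← h1, ← h2]
        simp
  · -- the quotient is the image of the compact unit square under `g_a`
    let F : ℝ × ℝ → (ℝ × ℝ) ⧸ lattice a := fun s =>
      ((1 / (2 * a) * (s.1 - a * s.2), 1 / (2 * a) * (s.1 + a * s.2)) : ℝ × ℝ)
    have hF : Continuous F := QuotientAddGroup.continuous_mk.comp (by fun_prop)
    have hK : IsCompact (Set.Icc (0 : ℝ) 1 ×ˢ Set.Icc (0 : ℝ) 1) := isCompact_Icc.prod isCompact_Icc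
    refine ⟨?_⟩
    convert hK.image hF
    refine (Set.eq_univ_of_forall fun ω => ?_).symm
    obtain ⟨z, rfl⟩ := QuotientAddGroup.mk_surjective ω
    refine ⟨(Int.fract (a * (z.1 + z.2)), Int.fract (z.2 - z.1)),
      ⟨⟨Int.fract_nonneg _, (Int.fract_lt_one _).le⟩,
        ⟨Int.fract_nonneg _, (Int.fract_lt_one _).le⟩⟩, ?_⟩
    refine QuotientAddGroup.eq.2 ⟨(⌊a * (z.1 + z.2)⌋, ⌊z.2 - z.1⌋), ?_⟩
    ext
    · simp only [latticeHom, AddMonoidHom.coe_mk, ZeroHom.coe_mk, Int.fract, Prod.fst_add,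
        Prod.fst_neg]
      field_simp; ring
    · simp only [latticeHom, AddMonoidHom.coe_mk, ZeroHom.coe_mk, Int.fract, Prod.snd_add,
        Prod.snd_neg]
      field_simp; ring
  · rintro _ ⟨k, rfl⟩ _ ⟨l, rfl⟩ h
    simp only [latticeHom, AddMonoidHom.coe_mk, ZeroHom.coe_mk] at h
    have h1 : (k.1 : ℝ) - a * k.2 = l.1 - a * l.2 :=
      mul_left_cancel₀ (one_div_ne_zero (mul_ne_zero two_ne_zero ha')) h
    have h2 : k.2 = l.2 := by
      by_contra hne
      have hne' : k.2 - l.2 ≠ 0 := sub_ne_zero.2 hne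
      have h3 := (hirr.mul_intCast hne').ne_int (k.1 - l.1)
      apply h3
      push_cast
      linarith
    have h3 : k.1 = l.1 := by
      rw [h2] at h1
      exact_mod_cast sub_left_injective h1
    rw [Prod.ext h3 h2]
  · have hd : Dense (AddSubgroup.closure {(1 / 2 : ℝ), 1 / (2 * a)} : Set ℝ) := by
      rw [dense_addSubgroupClosure_pair_iff]
      have : (1 / 2 : ℝ) / (1 / (2 * a)) = a := by field_simp
      rwa [this]
    refine hd.mono ?_
    have hle : AddSubgroup.closure {(1 / 2 : ℝ), 1 / (2 * a)} ≤
        (lattice a).map (AddMonoidHom.snd ℝ ℝ) := by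
      rw [AddSubgroup.closure_le]
      rintro x (rfl | rfl)
      · refine ⟨_, ⟨(0, 1), rfl⟩, ?_⟩
        simp [latticeHom]; field_simp
      · refine ⟨_, ⟨(1, 0), rfl⟩, ?_⟩
        simp [latticeHom]
    intro x hx
    exact hle hx

/-- The distance `min {|θ + n| : n ∈ ℤ}` of a real number to the nearest integer. -/
def distInt (θ : ℝ) : ℝ := ⨅ n : ℤ, |θ + n|

theorem distInt_eq (θ : ℝ) : distInt θ = |θ - round θ| := by
  refine le_antisymm ?_ (le_ciInf fun n => ?_)
  · have := ciInf_le (f := fun n : ℤ => |θ + n|)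
      ⟨0, by rintro _ ⟨n, rfl⟩; exact abs_nonneg _⟩ (-round θ)
    simpa [distInt, sub_eq_add_neg] using this
  · simpa using round_le θ (-n)

end CutProject

end

open scoped ENNReal

noncomputable section

namespace CutProject

/-! ### Parseval's identity for periodizations -/

section Periodization

-- The diffraction is computed as an explicit pure point measure, and a single atom near the origin
-- is already heavy enough.
--
-- In lattice coordinates on `ℝ² / Γ_a ≅ (ℝ/ℤ)²`, the linear statistic `p_ω(f)` is the periodization
-- of `f ⊗ 1_W`. Its `L²` norm has two expressions. Unfolding over lattice differences gives `η⁺(f *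
-- f^*)` (`autocorrelation_process`, `integral_statFun_add_mul_conj`), while Parseval gives a sum
-- over the dual lattice of `|2a 𝓕1_W(a n₀ + n₁)|² |𝓕f(a n₀ - n₁)|²` (`integral_mFourier_statFun`).
-- The term `n = 0` is exactly the square of the mean, so centering removes it and the measure
-- `bragg` satisfies the defining identity of the centered diffraction. Since `centeredDiffraction`
-- is an arbitrary choice among the solutions of that identity, a uniqueness statement is needed;
-- agreement on points (`IsFourierTransform.measure_singleton_eq`) suffices here.
--
-- For `W = [-b, b]` the weight is `(2a / πτ)² sin²(2πbτ)` with `τ = a n₀ + n₁`. Take `n = (m, round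
-- (m a))`: the atom lies at distance `{m a}` from `0`, while `τ` is comparable to `m`. The weight
-- is therefore at least `c m⁻²` along a subsequence unless `sin²(2πbτ)` tends to `0`, and by the
-- Riemann–Lebesgue lemma this happens only for a null set of `b` (`ae_not_tendsto_sin_sq`). If `{m
-- a} ≤ m^(-γ)`, comparing with `u = 2 m^(-γ)` gives a ratio of order `m^(γδ - 2)`, which diverges
-- when `δ > 2/γ`. A Liouville `a` allows every `γ`, hence every `δ > 0`; `δ = 1` contradicts
-- hyperuniformity.

local instance : MeasureSpace UnitAddCircle := ⟨AddCircle.haarAddCircle⟩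

local instance : Measure.IsAddHaarMeasure (volume : Measure UnitAddCircle) :=
  inferInstanceAs (Measure.IsAddHaarMeasure AddCircle.haarAddCircle)

local instance : IsProbabilityMeasure (volume : Measure UnitAddCircle) :=
  inferInstanceAs (IsProbabilityMeasure AddCircle.haarAddCircle)

open UnitAddTorus

variable {d : Type*}

/-- The half-open unit box. -/
def unitBox (d : Type*) : Set (d → ℝ) := {x | ∀ i, x i ∈ Set.Ioc ((0 : d → ℝ) i) ((0 : d → ℝ) i + 1)}

/-- The inclusion of the integer vectors. -/
def intVec (k : d → ℤ) : d → ℝ := fun i => k i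

/-- The projection of `ℝᵈ` to the torus. -/
def toTorus (x : d → ℝ) : UnitAddTorus d := fun i => (x i : UnitAddCircle)

theorem toTorus_add_intVec (x : d → ℝ) (k : d → ℤ) : toTorus (x + intVec k) = toTorus x := by
  funext i
  simp only [toTorus, intVec, Pi.add_apply]
  rw [AddCircle.coe_add]
  have : ((k i : ℝ) : UnitAddCircle) = 0 := (AddCircle.coe_eq_zero_iff 1).2 ⟨k i, by simp⟩
  rw [this, add_zero]

theorem measurable_toTorus : Measurable (toTorus (d := d)) :=
  measurable_pi_lambda _ fun i => AddCircle.measurable_mk'.comp (measurable_pi_apply i)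

/-- Bounded measurable functions with bounded support. -/
structure IsTest (G : (d → ℝ) → ℂ) : Prop where
  measurable : Measurable G
  bounded : ∃ C, ∀ x, ‖G x‖ ≤ C
  support : ∃ R, ∀ x, G x ≠ 0 → ∀ i, |x i| ≤ R

/-- The sum of the translates of a function by the integer vectors. -/
def periodize (G : (d → ℝ) → ℂ) (x : d → ℝ) : ℂ := ∑' k : d → ℤ, G (x + intVec k)

variable {G : (d → ℝ) → ℂ}

theorem IsTest.mul_left (hG : IsTest G) {H : (d → ℝ) → ℂ} (hH : Measurable H) {C : ℝ}
    (hC : ∀ x, ‖H x‖ ≤ C) : IsTest fun x => H x * G x := by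
  obtain ⟨C', hC'⟩ := hG.bounded
  obtain ⟨R, hR⟩ := hG.support
  refine ⟨hH.mul hG.measurable, ⟨C * C', fun x => ?_⟩, R, fun x hx => hR x (right_ne_zero_of_mul hx)⟩
  rw [norm_mul]
  exact mul_le_mul (hC x) (hC' x) (norm_nonneg _) ((norm_nonneg _).trans (hC x))

theorem periodize_add_intVec (G : (d → ℝ) → ℂ) (x : d → ℝ) (k : d → ℤ) :
    periodize G (x + intVec k) = periodize G x := by
  unfold periodize
  rw [← (Equiv.addLeft k).tsum_eq fun l => G (x + intVec l)]
  refine tsum_congr fun l => ?_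
  congr 1
  rw [add_assoc]
  congr 1
  funext i
  simp [intVec]

theorem IsTest.conj (hG : IsTest G) : IsTest fun x => conj (G x) := by
  obtain ⟨C, hC⟩ := hG.bounded
  obtain ⟨R, hR⟩ := hG.support
  exact ⟨Complex.continuous_conj.measurable.comp hG.measurable, ⟨C, fun x => by simpa using hC x⟩,
    R, fun x hx => hR x fun h => hx (by simp [h])⟩

variable [Fintype d]

theorem measurableSet_unitBox : MeasurableSet (unitBox d) :=
  MeasurableSet.univ_pi' fun _ => measurableSet_Ioc

/-- The integer translates of the half-open box tile `ℝᵈ`; this is what makes unfolding work. -/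
theorem volume_eq_sum_map_unitBox :
    (volume : Measure (d → ℝ)) =
      Measure.sum fun k : d → ℤ => (volume.restrict (unitBox d)).map fun x => x + intVec k := by
  have h1 : ∀ k : d → ℤ, (volume.restrict (unitBox d)).map (fun x => x + intVec k) =
      (volume : Measure (d → ℝ)).restrict ((fun x => x + -intVec k) ⁻¹' unitBox d) := by
    intro k
    have := (measurePreserving_add_right (volume : Measure (d → ℝ)) (intVec k)).restrict_preimage
      ((measurable_add_const (-intVec k)) (measurableSet_unitBox (d := d)))
    have h2 : (fun x : d → ℝ => x + intVec k) ⁻¹' ((fun x => x + -intVec k) ⁻¹' unitBox d) =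
        unitBox d := by
      ext x; simp
    rw [h2] at this
    exact this.map_eq
  simp_rw [h1]
  rw [← Measure.restrict_iUnion _ fun k => (measurable_add_const (-intVec k)) measurableSet_unitBox]
  · have : (⋃ k : d → ℤ, (fun x : d → ℝ => x + -intVec k) ⁻¹' unitBox d) = Set.univ := by
      refine Set.eq_univ_of_forall fun x => Set.mem_iUnion.2 ⟨fun i => ⌈x i⌉ - 1, fun i => ?_⟩
      simp only [intVec, Pi.add_apply, Pi.neg_apply, Pi.zero_apply, Set.mem_Ioc]
      push_cast
      constructor <;> linarith [Int.ceil_lt_add_one (x i), Int.le_ceil (x i)]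
    rw [this, Measure.restrict_univ]
  · intro k l hkl
    refine Set.disjoint_left.2 fun x hk hl => hkl (funext fun i => ?_)
    have h3 := hk i
    have h4 := hl i
    simp only [intVec, Pi.add_apply, Pi.neg_apply, Pi.zero_apply, Set.mem_Ioc] at h3 h4
    have h5 : ((k i : ℝ) - l i) < 1 := by linarith
    have h6 : ((l i : ℝ) - k i) < 1 := by linarith
    have h7 : k i - l i < 1 := by exact_mod_cast h5
    have h8 : l i - k i < 1 := by exact_mod_cast h6
    omega

/-- Unfolding a nonnegative function over the unit box. -/
theorem lintegral_unitBox_tsum {G : (d → ℝ) → ℝ≥0∞} (hG : Measurable G) :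
    ∫⁻ x in unitBox d, ∑' k : d → ℤ, G (x + intVec k) = ∫⁻ x, G x := by
  rw [lintegral_tsum fun k => (by fun_prop)]
  conv_rhs => rw [volume_eq_sum_map_unitBox, lintegral_sum_measure]
  exact tsum_congr fun k => (lintegral_map hG (measurable_add_const _)).symm

/-- Unfolding an integrable function over the unit box. -/
theorem integral_unitBox_tsum {G : (d → ℝ) → ℂ} (hm : Measurable G) (hG : Integrable G) :
    ∫ x in unitBox d, ∑' k : d → ℤ, G (x + intVec k) = ∫ x, G x := by
  have hG' : Integrable G (Measure.sum fun k : d → ℤ =>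
      (volume.restrict (unitBox d)).map fun x => x + intVec k) := by
    rwa [← volume_eq_sum_map_unitBox]
  have hk : ∀ k : d → ℤ, AEStronglyMeasurable (fun x => G (x + intVec k))
      (volume.restrict (unitBox d)) := fun k =>
    (hm.comp (measurable_add_const (intVec k))).aestronglyMeasurable
  rw [integral_tsum hk]
  · conv_rhs => rw [volume_eq_sum_map_unitBox, integral_sum_measure hG']
    exact tsum_congr fun k => (integral_map (measurable_add_const _).aemeasurable
      hm.aestronglyMeasurable).symm
  · rw [← lintegral_tsum fun k => (by fun_prop)]
    have := lintegral_unitBox_tsum (d := d) hm.enorm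
    rw [this]
    exact hG.2.ne

/-- **Parseval's identity** for a bounded measurable function on the unit box. -/
theorem hasSum_sq_integral_unitBox {h : (d → ℝ) → ℂ} (hm : Measurable h) {C : ℝ}
    (hC : ∀ x, ‖h x‖ ≤ C) :
    HasSum (fun n : d → ℤ => ‖∫ x in unitBox d, mFourier (-n) (toTorus x) * h x‖ ^ 2)
      (∫ x in unitBox d, ‖h x‖ ^ 2) := by
  -- `s` is the measurable section of `toTorus` with values in the box; it carries `h` to the torus,
  -- where Parseval is applied.
  let s : UnitAddTorus d → (d → ℝ) := fun t => (measurableEquivPiIoc (0 : d → ℝ) t).1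
  have hs : Measurable s := measurable_subtype_coe.comp (measurableEquivPiIoc _).measurable
  have hsx : ∀ x ∈ unitBox d, s (toTorus x) = x := fun x hx =>
    congrArg Subtype.val ((measurableEquivPiIoc (0 : d → ℝ)).apply_symm_apply ⟨x, hx⟩)
  have hL : MemLp (h ∘ s) 2 (volume : Measure (UnitAddTorus d)) :=
    MemLp.of_bound (hm.comp hs).aestronglyMeasurable C (ae_of_all _ fun t => hC _)
  have key := hasSum_sq_mFourierCoeff (hL.toLp (h ∘ s))
  have e1 : ∀ n : d → ℤ, mFourierCoeff (hL.toLp (h ∘ s)) n =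
      ∫ x in unitBox d, mFourier (-n) (toTorus x) * h x := by
    intro n
    have : mFourierCoeff (hL.toLp (h ∘ s)) n = mFourierCoeff (h ∘ s) n := by
      refine integral_congr_ae ?_
      filter_upwards [hL.coeFn_toLp] with t ht
      rw [ht]
    rw [this, mFourierCoeff_eq_integral _ _ 0]
    refine setIntegral_congr_fun measurableSet_unitBox fun x hx => ?_
    change mFourier (-n) (toTorus x) * h (s (toTorus x)) = _
    rw [hsx x hx]
  have e2 : ∫ t, ‖hL.toLp (h ∘ s) t‖ ^ 2 = ∫ x in unitBox d, ‖h x‖ ^ 2 := by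
    have : ∫ t, ‖hL.toLp (h ∘ s) t‖ ^ 2 = ∫ t, ‖(h ∘ s) t‖ ^ 2 := by
      refine integral_congr_ae ?_
      filter_upwards [hL.coeFn_toLp] with t ht
      rw [ht]
    rw [this, integral_preimage _ 0]
    refine setIntegral_congr_fun measurableSet_unitBox fun x hx => ?_
    change ‖h (s (toTorus x))‖ ^ 2 = _
    rw [hsx x hx]
  simp_rw [e1, e2] at key
  exact key

/-- After shifting the index by the integer part of `x`, only the `k` in a fixed finite box
contribute, so the bound is uniform in `x`. -/
theorem exists_tsum_enorm_le {C R : ℝ} (hC : ∀ x, ‖G x‖ ≤ C)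
    (hR : ∀ x, G x ≠ 0 → ∀ i, |x i| ≤ R) :
    ∃ K : ℝ≥0∞, K ≠ ⊤ ∧ ∀ x, ∑' k : d → ℤ, ‖G (x + intVec k)‖ₑ ≤ K := by
  classical
  let S : Finset (d → ℤ) := Fintype.piFinset fun _ => Finset.Icc (-⌈R + 1⌉) ⌈R + 1⌉
  refine ⟨∑ _k ∈ S, ENNReal.ofReal C, by simp [ENNReal.mul_eq_top], fun x => ?_⟩
  rw [← (Equiv.addRight (fun i => -⌊x i⌋ : d → ℤ)).tsum_eq, tsum_eq_sum (s := S)]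
  · refine Finset.sum_le_sum fun k _ => ?_
    rw [← ofReal_norm]
    exact ENNReal.ofReal_le_ofReal (hC _)
  · intro k hk
    by_contra hne
    refine hk (Fintype.mem_piFinset.2 fun i => ?_)
    have h1 := hR _ (fun h => hne (by rw [h, enorm_zero])) i
    simp only [Equiv.coe_addRight, intVec, Pi.add_apply] at h1
    push_cast at h1
    have h2 := abs_le.1 h1
    have h3 := Int.floor_le (x i)
    have h4 := Int.lt_floor_add_one (x i)
    have h5 := Int.le_ceil (R + 1)
    rw [Finset.mem_Icc]
    constructor
    · have : (-⌈R + 1⌉ : ℝ) ≤ k i := by linarith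
      exact_mod_cast this
    · have : (k i : ℝ) ≤ ⌈R + 1⌉ := by linarith
      exact_mod_cast this

theorem IsTest.exists_tsum_enorm_le (hG : IsTest G) :
    ∃ K : ℝ≥0∞, K ≠ ⊤ ∧ ∀ x, ∑' k : d → ℤ, ‖G (x + intVec k)‖ₑ ≤ K := by
  obtain ⟨C, hC⟩ := hG.bounded
  obtain ⟨R, hR⟩ := hG.support
  exact CutProject.exists_tsum_enorm_le hC hR

theorem IsTest.integrable (hG : IsTest G) : Integrable G := by
  obtain ⟨C, hC⟩ := hG.bounded
  obtain ⟨R, hR⟩ := hG.support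
  have hs : Function.support G ⊆ Set.Icc (fun _ => -R) (fun _ => R) := fun x hx =>
    ⟨fun i => (abs_le.1 (hR x hx i)).1, fun i => (abs_le.1 (hR x hx i)).2⟩
  rw [← integrableOn_iff_integrable_of_support_subset hs]
  refine IntegrableOn.of_bound isCompact_Icc.measure_lt_top hG.measurable.aestronglyMeasurable C
    (ae_of_all _ hC)

theorem IsTest.summable_norm (hG : IsTest G) (x : d → ℝ) :
    Summable fun k : d → ℤ => ‖G (x + intVec k)‖ := by
  obtain ⟨K, hK, h⟩ := hG.exists_tsum_enorm_le
  have h1 : ∑' k : d → ℤ, ‖G (x + intVec k)‖ₑ ≠ ⊤ := ne_top_of_le_ne_top hK (h x)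
  simpa using ENNReal.summable_toReal h1

theorem IsTest.norm_periodize_le (hG : IsTest G) : ∃ C, ∀ x, ‖periodize G x‖ ≤ C := by
  obtain ⟨K, hK, h⟩ := hG.exists_tsum_enorm_le
  refine ⟨K.toReal, fun x => ?_⟩
  refine (norm_tsum_le_tsum_norm (hG.summable_norm x)).trans ?_
  have h1 : ∑' k : d → ℤ, ‖G (x + intVec k)‖ₑ ≠ ⊤ := ne_top_of_le_ne_top hK (h x)
  have h2 := ENNReal.toReal_mono hK (h x)
  rw [ENNReal.tsum_toReal_eq fun k => enorm_ne_top] at h2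
  simpa using h2

theorem IsTest.measurable_periodize (hG : IsTest G) : Measurable (periodize G) := by
  have := fun k : d → ℤ => hG.measurable.comp (measurable_add_const (intVec k))
  exact Measurable.tsum this

/-- **Parseval's identity** for periodizations. -/
theorem IsTest.hasSum_sq_integral (hG : IsTest G) :
    HasSum (fun n : d → ℤ => ‖∫ x, mFourier (-n) (toTorus x) * G x‖ ^ 2)
      (∫ x in unitBox d, ‖periodize G x‖ ^ 2) := by
  obtain ⟨C, hC⟩ := hG.norm_periodize_le
  refine (hasSum_sq_integral_unitBox hG.measurable_periodize hC).congr_fun fun n => ?_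
  have h1 : IsTest fun x => mFourier (-n) (toTorus x) * G x :=
    hG.mul_left (C := 1) ((mFourier (-n)).continuous.measurable.comp measurable_toTorus) fun x =>
      ((mFourier (-n)).norm_coe_le_norm _).trans mFourier_norm.le
  rw [← integral_unitBox_tsum h1.measurable h1.integrable]
  simp only [toTorus_add_intVec, tsum_mul_left]
  rfl

/-- The geometric side of Parseval: one factor of `|periodize G|²` is unfolded from the box to all
of `ℝᵈ`, the other being periodic, and the remaining periodization is then expanded. -/
theorem IsTest.integral_sq_periodize (hG : IsTest G) :
    ((∫ x in unitBox d, ‖periodize G x‖ ^ 2 : ℝ) : ℂ) =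
      ∑' m : d → ℤ, ∫ x, G (x + intVec m) * conj (G x) := by
  obtain ⟨C, hC⟩ := hG.norm_periodize_le
  have h1 : IsTest fun x => periodize G x * conj (G x) :=
    hG.conj.mul_left hG.measurable_periodize hC
  have h2 : ((∫ x in unitBox d, ‖periodize G x‖ ^ 2 : ℝ) : ℂ) =
      ∫ x, periodize G x * conj (G x) := by
    rw [← integral_unitBox_tsum h1.measurable h1.integrable, ← integral_complex_ofReal]
    refine integral_congr_ae (ae_of_all _ fun x => ?_)
    simp only [periodize_add_intVec, tsum_mul_left]
    rw [← Complex.conj_tsum]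
    change _ = periodize G x * conj (periodize G x)
    rw [Complex.mul_conj, Complex.normSq_eq_norm_sq]
  have h3 : ∀ m : d → ℤ, Measurable fun x => G (x + intVec m) * conj (G x) := fun m =>
    (hG.measurable.comp (measurable_add_const _)).mul hG.conj.measurable
  rw [h2]
  simp_rw [periodize, ← tsum_mul_right]
  rw [integral_tsum fun m => (h3 m).aestronglyMeasurable]
  rw [← lintegral_tsum fun m => (h3 m).enorm.aemeasurable]
  obtain ⟨K, hK, h⟩ := hG.exists_tsum_enorm_le
  have : ∫⁻ x, ∑' m : d → ℤ, ‖G (x + intVec m) * conj (G x)‖ₑ ≤ ∫⁻ x, K * ‖G x‖ₑ := by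
    refine lintegral_mono fun x => ?_
    simp only [enorm_mul, ENNReal.tsum_mul_right, RCLike.enorm_conj]
    gcongr
    exact h x
  refine ne_top_of_le_ne_top ?_ this
  rw [lintegral_const_mul _ hG.measurable.enorm]
  exact ENNReal.mul_ne_top hK hG.integrable.2.ne

end Periodization

/-! ### The torus of the lattice `Γ_a` -/

section Torus

/-- The linear map of `ℝ²` with matrix `(2a)⁻¹ [[1, -a], [1, a]]`. -/
def latMap (a : ℝ) (s : Fin 2 → ℝ) : ℝ × ℝ :=
  (1 / (2 * a) * (s 0 - a * s 1), 1 / (2 * a) * (s 0 + a * s 1))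

/-- The lattice point with index `k`. -/
def latPt (a : ℝ) (k : Fin 2 → ℤ) : ℝ × ℝ := latMap a (intVec k)

theorem latMap_add (a : ℝ) (s t : Fin 2 → ℝ) : latMap a (s + t) = latMap a s + latMap a t := by
  ext <;> simp [latMap] <;> ring

theorem continuous_latMap (a : ℝ) : Continuous (latMap a) := by
  unfold latMap; fun_prop

theorem latPt_add (a : ℝ) (k l : Fin 2 → ℤ) : latPt a (k + l) = latPt a k + latPt a l := by
  rw [latPt, latPt, latPt, ← latMap_add]
  congr 1
  funext i
  simp [intVec]

theorem latPt_eq_latticeHom (a : ℝ) (k : Fin 2 → ℤ) : latPt a k = latticeHom a (k 0, k 1) := rfl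

theorem mem_lattice_iff {a : ℝ} {z : ℝ × ℝ} : z ∈ lattice a ↔ ∃ k, latPt a k = z := by
  constructor
  · rintro ⟨k, rfl⟩
    exact ⟨![k.1, k.2], rfl⟩
  · rintro ⟨k, rfl⟩
    exact ⟨_, (latPt_eq_latticeHom a k).symm⟩

variable {a : ℝ}

theorem latMap_injective (ha : 0 < a) : Function.Injective (latMap a) := by
  intro s t h
  have h1 := congrArg Prod.fst h
  have h2 := congrArg Prod.snd h
  simp only [latMap] at h1 h2
  have h3 := mul_left_cancel₀ (one_div_ne_zero (mul_ne_zero two_ne_zero ha.ne')) h1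
  have h4 := mul_left_cancel₀ (one_div_ne_zero (mul_ne_zero two_ne_zero ha.ne')) h2
  have h5 : s 0 = t 0 := by linarith
  have h6 : s 1 = t 1 := mul_left_cancel₀ ha.ne' (by linarith)
  funext i
  fin_cases i
  · exact h5
  · exact h6

theorem latPt_injective (ha : 0 < a) : Function.Injective (latPt a) := fun k l h => by
  funext i
  exact Int.cast_injective (α := ℝ) (congrFun (latMap_injective ha h) i)

theorem latMap_inverse (ha : 0 < a) (z : ℝ × ℝ) :
    latMap a ![a * (z.1 + z.2), z.2 - z.1] = z := by
  ext <;> simp [latMap] <;> field_simp <;> ring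

/-- The matrix has determinant `1 / (2a)`, the covolume of the lattice. -/
theorem map_latMap_volume (ha : 0 < a) :
    (volume : Measure (Fin 2 → ℝ)).map (latMap a) =
      ENNReal.ofReal (2 * a) • (volume : Measure (ℝ × ℝ)) := by
  let A : Matrix (Fin 2) (Fin 2) ℝ := !![1 / (2 * a), -(1 / 2); 1 / (2 * a), 1 / 2]
  have hdet : A.det = 1 / (2 * a) := by
    simp only [A, Matrix.det_fin_two_of]
    ring
  have hA : A.det ≠ 0 := by rw [hdet]; positivity
  have h1 : latMap a = MeasurableEquiv.finTwoArrow ∘ Matrix.toLin' A := by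
    funext s
    ext <;> simp [latMap, A, Matrix.mulVec, dotProduct, Fin.sum_univ_two] <;> field_simp <;> ring
  rw [h1, ← Measure.map_map MeasurableEquiv.finTwoArrow.measurable
    (LinearMap.continuous_on_pi _).measurable, Real.map_matrix_volume_pi_eq_smul_volume_pi hA,
    Measure.map_smul, (volume_preserving_finTwoArrow ℝ).map_eq, hdet]
  congr 2
  rw [one_div, inv_inv, abs_of_pos (by positivity)]

local instance : MeasureSpace UnitAddCircle := ⟨AddCircle.haarAddCircle⟩

local instance : Measure.IsAddHaarMeasure (volume : Measure UnitAddCircle) :=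
  inferInstanceAs (Measure.IsAddHaarMeasure AddCircle.haarAddCircle)

local instance : IsProbabilityMeasure (volume : Measure UnitAddCircle) :=
  inferInstanceAs (IsProbabilityMeasure AddCircle.haarAddCircle)

/-- The homomorphism `ℝ → ℝ² / Γ_a` along the `i`-th basis vector of the lattice. -/
def axisHom (a : ℝ) (i : Fin 2) : ℝ →+ (ℝ × ℝ) ⧸ lattice a where
  toFun x := (latMap a (Pi.single i x) : ℝ × ℝ)
  map_zero' := by
    have h : latMap a (Pi.single i 0) = 0 := by ext <;> simp [latMap]
    rw [h]
    rfl
  map_add' x y := by rw [Pi.single_add, latMap_add]; rfl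

theorem continuous_axisHom (a : ℝ) (i : Fin 2) : Continuous (axisHom a i) :=
  QuotientAddGroup.continuous_mk.comp ((continuous_latMap a).comp
    (continuous_single (A := fun _ : Fin 2 => ℝ) i))

/-- The homomorphism `ℝ / ℤ → ℝ² / Γ_a` along the `i`-th basis vector of the lattice. -/
def circleHom (a : ℝ) (i : Fin 2) : UnitAddCircle →+ (ℝ × ℝ) ⧸ lattice a :=
  QuotientAddGroup.lift (AddSubgroup.zmultiples (1 : ℝ)) (axisHom a i) (by
    rw [AddSubgroup.zmultiples_le]
    refine (QuotientAddGroup.eq_zero_iff _).2 (mem_lattice_iff.2 ⟨Pi.single i 1, ?_⟩)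
    rw [latPt]
    congr 1
    funext j
    rcases eq_or_ne j i with rfl | h
    · simp [intVec]
    · simp [intVec, h])

/-- The isomorphism `(ℝ / ℤ)² → ℝ² / Γ_a`. -/
def torusHom (a : ℝ) : UnitAddTorus (Fin 2) →+ (ℝ × ℝ) ⧸ lattice a where
  toFun t := circleHom a 0 (t 0) + circleHom a 1 (t 1)
  map_zero' := by simp
  map_add' s t := by simp only [Pi.add_apply, map_add]; abel

theorem torusHom_toTorus (a : ℝ) (s : Fin 2 → ℝ) :
    torusHom a (toTorus s) = ((latMap a s : ℝ × ℝ) : (ℝ × ℝ) ⧸ lattice a) := by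
  change ((latMap a (Pi.single 0 (s 0)) : ℝ × ℝ) : (ℝ × ℝ) ⧸ lattice a) +
    ((latMap a (Pi.single 1 (s 1)) : ℝ × ℝ) : (ℝ × ℝ) ⧸ lattice a) = _
  rw [← QuotientAddGroup.mk_add, ← latMap_add]
  congr 2
  funext j
  fin_cases j <;> simp

theorem continuous_torusHom (a : ℝ) : Continuous (torusHom a) := by
  have h : ∀ i, Continuous (circleHom a i) := fun i =>
    (continuous_axisHom a i).quotient_lift _
  exact ((h 0).comp (continuous_apply 0)).add ((h 1).comp (continuous_apply 1))

theorem torusHom_surjective (ha : 0 < a) : Function.Surjective (torusHom a) := by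
  intro ω
  obtain ⟨z, rfl⟩ := QuotientAddGroup.mk_surjective ω
  exact ⟨toTorus ![a * (z.1 + z.2), z.2 - z.1], by rw [torusHom_toTorus, latMap_inverse ha]⟩

/-- A continuous surjective homomorphism pushes Haar probability measure to Haar probability
measure, and the latter is unique. -/
theorem torusMeasure_eq_map (ha : 0 < a) (h : IsCutProjectLattice (lattice a)) :
    torusMeasure (lattice a) h = (volume : Measure (UnitAddTorus (Fin 2))).map (torusHom a) := by
  have := h.discrete
  have := h.cocompact
  have : IsClosed (lattice a : Set (ℝ × ℝ)) := AddSubgroup.isClosed_of_discrete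
  have : IsProbabilityMeasure ((volume : Measure (UnitAddTorus (Fin 2))).map (torusHom a)) :=
    Measure.isProbabilityMeasure_map (continuous_torusHom a).measurable.aemeasurable
  have : ((volume : Measure (UnitAddTorus (Fin 2))).map (torusHom a)).IsAddHaarMeasure :=
    Measure.isAddHaarMeasure_map_of_isFiniteMeasure _ _ (continuous_torusHom a)
      (torusHom_surjective ha)
  have : IsProbabilityMeasure (torusMeasure (lattice a) h) :=
    ⟨Measure.addHaarMeasure_self⟩
  have : (torusMeasure (lattice a) h).IsAddHaarMeasure :=
    inferInstanceAs (Measure.IsAddHaarMeasure (Measure.addHaarMeasure ⊤))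
  exact Measure.isAddHaarMeasure_eq_of_isProbabilityMeasure _ _

/-- Unfolding over `ℝ² / Γ_a`: expectations of lattice sums become integrals over the plane,
normalized by the inverse covolume `2a`. -/
theorem lintegral_torusMeasure (ha : 0 < a) (h : IsCutProjectLattice (lattice a))
    {Φ : (ℝ × ℝ) ⧸ lattice a → ℝ≥0∞} {G : ℝ × ℝ → ℝ≥0∞} (hG : Measurable G)
    (hΦ : ∀ z : ℝ × ℝ, Φ z = ∑' k : Fin 2 → ℤ, G (z + latPt a k)) :
    ∫⁻ ω, Φ ω ∂torusMeasure (lattice a) h = ENNReal.ofReal (2 * a) * ∫⁻ z, G z := by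
  have := h.discrete
  have : IsClosed (lattice a : Set (ℝ × ℝ)) := AddSubgroup.isClosed_of_discrete
  have hm : Measurable Φ := QuotientAddGroup.measurable_from_quotient.2 <| by
    have : (Φ ∘ (QuotientAddGroup.mk : ℝ × ℝ → (ℝ × ℝ) ⧸ lattice a)) =
        fun z => ∑' k : Fin 2 → ℤ, G (z + latPt a k) := funext hΦ
    rw [this]
    exact Measurable.tsum fun k => hG.comp (measurable_add_const _)
  rw [torusMeasure_eq_map ha, lintegral_map hm (continuous_torusHom a).measurable,
    UnitAddTorus.lintegral_preimage _ 0]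
  have h1 : ∀ s : Fin 2 → ℝ, Φ (torusHom a (toTorus s)) =
      ∑' k : Fin 2 → ℤ, (G ∘ latMap a) (s + intVec k) := fun s => by
    rw [torusHom_toTorus, hΦ]
    exact tsum_congr fun k => by rw [Function.comp_apply, latMap_add]; rfl
  change ∫⁻ s in unitBox (Fin 2), Φ (torusHom a (toTorus s)) = _
  simp_rw [h1]
  rw [lintegral_unitBox_tsum (hG.comp (continuous_latMap a).measurable)]
  simp only [Function.comp_apply]
  rw [← lintegral_map hG (continuous_latMap a).measurable, map_latMap_volume ha,
    lintegral_smul_measure, smul_eq_mul]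

end Torus

/-! ### The moment measures of the process -/

section Moments

/-- The contribution of a point `z` of `ℝ × ℝ` to a cut-and-project process with window `W`. -/
def ptMass (W : Set ℝ) (z : ℝ × ℝ) : Measure ℝ := W.indicator (fun _ => Measure.dirac z.1) z.2

instance (W : Set ℝ) (z : ℝ × ℝ) : SFinite (ptMass W z) := by
  unfold ptMass
  by_cases h : z.2 ∈ W
  · rw [Set.indicator_of_mem h]; infer_instance
  · rw [Set.indicator_of_notMem h]; infer_instance

theorem ptMass_apply (W : Set ℝ) (z : ℝ × ℝ) {A : Set ℝ} (hA : MeasurableSet A) :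
    ptMass W z A = {w : ℝ × ℝ | w.2 ∈ W ∧ w.1 ∈ A}.indicator 1 z := by
  unfold ptMass
  by_cases h : z.2 ∈ W <;> by_cases h' : z.1 ∈ A <;> simp [h, h', hA]

theorem ptMass_prod_apply (W : Set ℝ) (z w : ℝ × ℝ) {B : Set (ℝ × ℝ)} (hB : MeasurableSet B) :
    (ptMass W z).prod (ptMass W w) B =
      {v : (ℝ × ℝ) × (ℝ × ℝ) | v.1.2 ∈ W ∧ v.2.2 ∈ W ∧ (v.1.1, v.2.1) ∈ B}.indicator 1 (z, w) := by
  unfold ptMass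
  by_cases h : z.2 ∈ W <;> by_cases h' : w.2 ∈ W <;> by_cases h'' : (z.1, w.1) ∈ B <;>
    simp [h, h', h'', hB, Measure.dirac_prod_dirac]

variable {a : ℝ} {W : Set ℝ}

/-- Injectivity of the first projection ensures that distinct lattice points give distinct points of
`Λ_ω`, so the sum over the point set is a sum over lattice indices without multiplicity issues. -/
theorem process_mk (ha : 0 < a) (h : IsCutProjectLattice (lattice a)) (z : ℝ × ℝ) :
    process (lattice a) W (z : (ℝ × ℝ) ⧸ lattice a) =
      Measure.sum fun k : Fin 2 → ℤ => ptMass W (z + latPt a k) := by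
  let S : Set (Fin 2 → ℤ) := {k | (z + latPt a k).2 ∈ W}
  have hmem : ∀ x : ℝ, x ∈ pointSet (lattice a) W (z : (ℝ × ℝ) ⧸ lattice a) ↔
      ∃ k ∈ S, (z + latPt a k).1 = x := by
    intro x
    change x ∈ translatedSet (lattice a) W z ↔ _
    rw [mem_translatedSet]
    constructor
    · rintro ⟨γ, hγ, h1, h2⟩
      obtain ⟨k, rfl⟩ := mem_lattice_iff.1 hγ
      exact ⟨k, by simpa [S, add_comm] using h1, by simpa [add_comm] using h2⟩
    · rintro ⟨k, h1, h2⟩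
      exact ⟨latPt a k, mem_lattice_iff.2 ⟨k, rfl⟩, by simpa [S, add_comm] using h1,
        by simpa [add_comm] using h2⟩
  let e : S → pointSet (lattice a) W (z : (ℝ × ℝ) ⧸ lattice a) := fun k =>
    ⟨(z + latPt a k.1).1, (hmem _).2 ⟨k.1, k.2, rfl⟩⟩
  have he : Function.Bijective e := by
    constructor
    · rintro ⟨k, hk⟩ ⟨l, hl⟩ hkl
      have h1 : (z + latPt a k).1 = (z + latPt a l).1 := congrArg Subtype.val hkl
      have h2 : latPt a k = latPt a l := h.injOn_fst (mem_lattice_iff.2 ⟨k, rfl⟩)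
        (mem_lattice_iff.2 ⟨l, rfl⟩) (by simpa using h1)
      exact Subtype.ext (latPt_injective ha h2)
    · rintro ⟨x, hx⟩
      obtain ⟨k, hk, rfl⟩ := (hmem x).1 hx
      exact ⟨⟨k, hk⟩, rfl⟩
  ext A hA
  rw [process, Measure.sum_apply _ hA, Measure.sum_apply _ hA,
    ← (Equiv.ofBijective e he).tsum_eq]
  have h1 : ∀ k : Fin 2 → ℤ, ptMass W (z + latPt a k) A =
      S.indicator (fun k => Measure.dirac (z + latPt a k).1 A) k := by
    intro k
    unfold ptMass
    by_cases hk : (z + latPt a k).2 ∈ W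
    · rw [Set.indicator_of_mem hk, Set.indicator_of_mem (show k ∈ S from hk)]
    · rw [Set.indicator_of_notMem hk, Set.indicator_of_notMem (show k ∉ S from hk)]
      rfl
  simp_rw [h1]
  rw [← tsum_subtype]
  rfl

theorem measurable_process (ha : 0 < a) (h : IsCutProjectLattice (lattice a))
    (hW : MeasurableSet W) : Measurable (process (lattice a) W) := by
  refine QuotientAddGroup.measurable_from_quotient.2 (Measure.measurable_of_measurable_coe _ ?_)
  intro A hA
  simp only [Function.comp_apply]
  simp_rw [process_mk ha h, Measure.sum_apply _ hA, ptMass_apply W _ hA]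
  refine Measurable.tsum fun k => ?_
  exact (measurable_one.indicator ((measurable_snd hW).inter (measurable_fst hA))).comp
    (measurable_add_const _)

/-- Pairs of lattice points are indexed by one of them and their difference `m`. The outer sum is
then a lattice sum in `z`, ready for unfolding. -/
theorem process_prod_mk_apply (ha : 0 < a) (h : IsCutProjectLattice (lattice a)) (z : ℝ × ℝ)
    {B : Set (ℝ × ℝ)} (hB : MeasurableSet B) :
    (process (lattice a) W (z : (ℝ × ℝ) ⧸ lattice a)).prod
        (process (lattice a) W (z : (ℝ × ℝ) ⧸ lattice a)) B =
      ∑' k : Fin 2 → ℤ, ∑' m : Fin 2 → ℤ,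
        (ptMass W (z + latPt a k + latPt a m)).prod (ptMass W (z + latPt a k)) B := by
  rw [process_mk ha h, Measure.prod_sum, Measure.sum_apply _ hB, ENNReal.tsum_prod',
    ENNReal.tsum_comm]
  refine tsum_congr fun k => ?_
  rw [← (Equiv.addLeft k).tsum_eq]
  refine tsum_congr fun m => ?_
  rw [Equiv.coe_addLeft, latPt_add, add_assoc]

theorem measurable_ptMass_prod (hW : MeasurableSet W) {B : Set (ℝ × ℝ)} (hB : MeasurableSet B)
    {X : Type*} [MeasurableSpace X] {f g : X → ℝ × ℝ} (hf : Measurable f) (hg : Measurable g) :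
    Measurable fun x => (ptMass W (f x)).prod (ptMass W (g x)) B := by
  simp_rw [ptMass_prod_apply W _ _ hB]
  refine (measurable_one.indicator ?_).comp (hf.prodMk hg)
  exact (hW.preimage (by fun_prop : Measurable fun v : (ℝ × ℝ) × (ℝ × ℝ) => v.1.2)).inter
    ((hW.preimage (by fun_prop : Measurable fun v : (ℝ × ℝ) × (ℝ × ℝ) => v.2.2)).inter
    (hB.preimage (by fun_prop : Measurable fun v : (ℝ × ℝ) × (ℝ × ℝ) => (v.1.1, v.2.1))))

theorem measurable_process_prod (ha : 0 < a) (h : IsCutProjectLattice (lattice a))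
    (hW : MeasurableSet W) :
    Measurable fun ω => (process (lattice a) W ω).prod (process (lattice a) W ω) := by
  refine QuotientAddGroup.measurable_from_quotient.2 (Measure.measurable_of_measurable_coe _ ?_)
  intro B hB
  simp only [Function.comp_apply]
  simp_rw [process_prod_mk_apply ha h _ hB]
  refine Measurable.tsum fun k => Measurable.tsum fun m => ?_
  exact measurable_ptMass_prod hW hB ((measurable_add_const _).comp (measurable_add_const _))
    (measurable_add_const _)

theorem firstMoment_apply (ha : 0 < a) (h : IsCutProjectLattice (lattice a))
    (hW : MeasurableSet W) {A : Set ℝ} (hA : MeasurableSet A) :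
    firstMoment (torusMeasure (lattice a) h) (process (lattice a) W) A =
      ENNReal.ofReal (2 * a) * (volume A * volume W) := by
  rw [firstMoment, Measure.bind_apply hA (measurable_process ha h hW).aemeasurable]
  have hm : MeasurableSet {w : ℝ × ℝ | w.2 ∈ W ∧ w.1 ∈ A} :=
    (measurable_snd hW).inter (measurable_fst hA)
  rw [lintegral_torusMeasure ha h (G := {w : ℝ × ℝ | w.2 ∈ W ∧ w.1 ∈ A}.indicator 1)
    (measurable_one.indicator hm) fun z => by
      rw [process_mk ha h, Measure.sum_apply _ hA]
      exact tsum_congr fun k => ptMass_apply W _ hA]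
  rw [lintegral_indicator_one hm]
  have : {w : ℝ × ℝ | w.2 ∈ W ∧ w.1 ∈ A} = A ×ˢ W := by
    ext w; simp [and_comm]
  rw [this, Measure.volume_eq_prod, Measure.prod_prod]

theorem secondMoment_apply (ha : 0 < a) (h : IsCutProjectLattice (lattice a))
    (hW : MeasurableSet W) {B : Set (ℝ × ℝ)} (hB : MeasurableSet B) :
    secondMoment (torusMeasure (lattice a) h) (process (lattice a) W) B =
      ENNReal.ofReal (2 * a) *
        ∑' m : Fin 2 → ℤ, ∫⁻ z, (ptMass W (z + latPt a m)).prod (ptMass W z) B := by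
  have hm : ∀ m : Fin 2 → ℤ, Measurable fun z : ℝ × ℝ =>
      (ptMass W (z + latPt a m)).prod (ptMass W z) B := fun m =>
    measurable_ptMass_prod hW hB (measurable_add_const _) measurable_id
  rw [secondMoment, Measure.bind_apply hB (measurable_process_prod ha h hW).aemeasurable]
  rw [lintegral_torusMeasure ha h (Measurable.tsum hm) fun z => process_prod_mk_apply ha h z hB]
  rw [lintegral_tsum fun m => (hm m).aemeasurable]

/-- The overlap of the window with its translate. -/
def overlap (W : Set ℝ) (t : ℝ) : ℝ≥0∞ := volume (W ∩ (fun h => h + t) ⁻¹' W)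

/-- For a fixed lattice difference `m`, the difference of the two points is the constant `(latPt a
m).1`. The remaining integral factors into the unit mass of `[0, 1)` and the overlap of the windows.
-/
theorem autocorrelation_process (ha : 0 < a) (h : IsCutProjectLattice (lattice a))
    (hW : MeasurableSet W) :
    autocorrelation (torusMeasure (lattice a) h) (process (lattice a) W) =
      Measure.sum fun m : Fin 2 → ℤ =>
        (ENNReal.ofReal (2 * a) * overlap W (latPt a m).2) • Measure.dirac (latPt a m).1 := by
  classical
  ext A hA
  have hsub : Measurable fun z : ℝ × ℝ => z.1 - z.2 := by fun_prop
  have hB : MeasurableSet ((fun z : ℝ × ℝ => z.1 - z.2) ⁻¹' A ∩ {z | z.2 ∈ Set.Ico (0 : ℝ) 1}) :=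
    (hsub hA).inter (measurable_snd measurableSet_Ico)
  rw [autocorrelation, Measure.map_apply hsub hA, Measure.restrict_apply (hsub hA),
    secondMoment_apply ha h hW hB, Measure.sum_apply _ hA, ← ENNReal.tsum_mul_left]
  refine tsum_congr fun m => ?_
  rw [Measure.smul_apply, smul_eq_mul, mul_assoc]
  congr 1
  have hm : MeasurableSet (W ∩ (fun h => h + (latPt a m).2) ⁻¹' W) :=
    hW.inter ((measurable_add_const _) hW)
  by_cases hA' : (latPt a m).1 ∈ A
  · have h1 : ∀ z : ℝ × ℝ, (ptMass W (z + latPt a m)).prod (ptMass W z)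
        ((fun z : ℝ × ℝ => z.1 - z.2) ⁻¹' A ∩ {z | z.2 ∈ Set.Ico (0 : ℝ) 1}) =
        (Set.Ico (0 : ℝ) 1 ×ˢ (W ∩ (fun h => h + (latPt a m).2) ⁻¹' W)).indicator 1 z := by
      intro z
      rw [ptMass_prod_apply W _ _ hB]
      simp only [Set.indicator_apply]
      refine if_congr ?_ rfl rfl
      simp only [Set.mem_ofPred_eq, Prod.fst_add, Prod.snd_add, Set.mem_inter_iff,
        Set.mem_preimage, add_sub_cancel_left, hA', true_and, Set.mem_prod]
      tauto
    simp_rw [h1]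
    rw [lintegral_indicator_one (measurableSet_Ico.prod hm), Measure.volume_eq_prod,
      Measure.prod_prod]
    simp [hA', hA, overlap]
  · have h1 : ∀ z : ℝ × ℝ, (ptMass W (z + latPt a m)).prod (ptMass W z)
        ((fun z : ℝ × ℝ => z.1 - z.2) ⁻¹' A ∩ {z | z.2 ∈ Set.Ico (0 : ℝ) 1}) = 0 := by
      intro z
      rw [ptMass_prod_apply W _ _ hB]
      refine Set.indicator_of_notMem ?_ _
      simp [hA']
    simp_rw [h1]
    simp [hA', hA]

end Moments

/-! ### The diffraction formula -/

section Diffraction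

theorem integral_convStar {f : ℝ → ℂ} (hf : Integrable f) :
    ∫ x, convStar f x = (∫ x, f x) * conj (∫ x, f x) := by
  have h1 : convStar f = convolution f (fun y => conj (f (-y))) (ContinuousLinearMap.mul ℝ ℂ)
      volume := by
    funext x
    simp [convStar, convolution]
  have h2 : Integrable fun y => conj (f y) := by
    rwa [← LinearIsometryEquiv.integrable_comp_iff Complex.conjLIE] at hf
  rw [h1, integral_convolution _ hf h2.comp_neg, ContinuousLinearMap.mul_apply',
    integral_neg_eq_self (fun y => conj (f y)) volume, integral_conj]

theorem convStar_eq (f : ℝ → ℂ) (x : ℝ) : convStar f x = ∫ t, f (t + x) * conj (f t) := by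
  rw [convStar, ← integral_add_right_eq_self _ x]
  simp

/-- The function on `ℝ²` whose periodization is the linear statistic of `f`, in lattice
coordinates. -/
def statFun (a : ℝ) (W : Set ℝ) (f : ℝ → ℂ) (s : Fin 2 → ℝ) : ℂ :=
  f (latMap a s).1 * W.indicator (fun _ => (1 : ℂ)) (latMap a s).2

/-- The first coordinate of the dual lattice point with index `n`. -/
def freq (a : ℝ) (n : Fin 2 → ℤ) : ℝ := a * n 0 - n 1

/-- The second coordinate of the dual lattice point with index `n`. -/
def starFreq (a : ℝ) (n : Fin 2 → ℤ) : ℝ := a * n 0 + n 1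

variable {a : ℝ} {W : Set ℝ} {f : ℝ → ℂ}

theorem isTest_statFun (ha : 0 < a) (hW : MeasurableSet W) (hb : Bornology.IsBounded W)
    (hf : Continuous f) (hs : HasCompactSupport f) : IsTest (statFun a W f) := by
  have hc := continuous_latMap a
  obtain ⟨C, hC⟩ := hf.bounded_above_of_compact_support hs
  obtain ⟨R₁, hR₁⟩ := hs.isCompact.isBounded.subset_closedBall (0 : ℝ)
  obtain ⟨R₂, hR₂⟩ := hb.subset_closedBall (0 : ℝ)
  refine ⟨?_, ⟨C, fun s => ?_⟩, (a + 1) * (R₁ + R₂), fun s hs' => ?_⟩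
  · exact (hf.measurable.comp (measurable_fst.comp hc.measurable)).mul
      ((measurable_const.indicator hW).comp (measurable_snd.comp hc.measurable))
  · rw [statFun, norm_mul]
    refine (mul_le_of_le_one_right (norm_nonneg _) ?_).trans (hC _)
    by_cases h : (latMap a s).2 ∈ W <;> simp [h]
  · have h1 := hR₁ (subset_tsupport f (left_ne_zero_of_mul hs'))
    have h2 := hR₂ (Set.mem_of_indicator_ne_zero (right_ne_zero_of_mul hs'))
    rw [mem_closedBall_zero_iff, Real.norm_eq_abs] at h1 h2
    have h3 : a * ((latMap a s).1 + (latMap a s).2) = s 0 := by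
      simp only [latMap]; field_simp; ring
    have h4 : (latMap a s).2 - (latMap a s).1 = s 1 := by
      simp only [latMap]; field_simp; ring
    have h5 := abs_le.1 h1
    have h6 := abs_le.1 h2
    have h7 : 0 ≤ R₁ + R₂ := add_nonneg ((abs_nonneg _).trans h1) ((abs_nonneg _).trans h2)
    intro i
    fin_cases i
    · change |s 0| ≤ _
      rw [← h3, abs_mul, abs_of_pos ha]
      have : |(latMap a s).1 + (latMap a s).2| ≤ R₁ + R₂ := (abs_add_le _ _).trans (add_le_add h1 h2)
      nlinarith
    · change |s 1| ≤ _
      rw [← h4]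
      have : |(latMap a s).2 - (latMap a s).1| ≤ R₁ + R₂ := by
        rw [abs_le]; constructor <;> linarith
      nlinarith

theorem integral_comp_latMap (ha : 0 < a) {g : ℝ × ℝ → ℂ} (hg : Measurable g) :
    ∫ s, g (latMap a s) = ((2 * a : ℝ) : ℂ) * ∫ z, g z := by
  rw [← integral_map (continuous_latMap a).measurable.aemeasurable hg.aestronglyMeasurable,
    map_latMap_volume ha, integral_smul_measure, ENNReal.toReal_ofReal (by positivity),
    Complex.real_smul]

theorem integral_mul_comp_latMap (ha : 0 < a) {u v : ℝ → ℂ} (hu : Measurable u)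
    (hv : Measurable v) :
    ∫ s, u (latMap a s).1 * v (latMap a s).2 = ((2 * a : ℝ) : ℂ) * ((∫ x, u x) * ∫ y, v y) := by
  rw [← integral_prod_mul, ← Measure.volume_eq_prod]
  exact integral_comp_latMap ha (g := fun z : ℝ × ℝ => u z.1 * v z.2)
    ((hu.comp measurable_fst).mul (hv.comp measurable_snd))

theorem mFourier_neg_toTorus (ha : 0 < a) (n : Fin 2 → ℤ) (s : Fin 2 → ℝ) :
    UnitAddTorus.mFourier (-n) (toTorus s) =
      Complex.exp (↑(-2 * Real.pi * (latMap a s).1 * freq a n) * Complex.I) *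
        Complex.exp (↑(-2 * Real.pi * (latMap a s).2 * starFreq a n) * Complex.I) := by
  have ha' : (a : ℂ) ≠ 0 := by exact_mod_cast ha.ne'
  simp only [UnitAddTorus.mFourier, ContinuousMap.coe_mk, toTorus, Fin.prod_univ_two,
    fourier_coe_apply, ← Complex.exp_add]
  congr 1
  simp only [latMap, freq, starFreq, Pi.neg_apply]
  push_cast
  field_simp
  ring

theorem integral_mFourier_statFun (ha : 0 < a) (hW : MeasurableSet W) (hf : Continuous f)
    (n : Fin 2 → ℤ) :
    ∫ s, UnitAddTorus.mFourier (-n) (toTorus s) * statFun a W f s =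
      ((2 * a : ℝ) : ℂ) * (𝓕 f (freq a n) *
        𝓕 (W.indicator fun _ => (1 : ℂ)) (starFreq a n)) := by
  let u : ℝ → ℂ := fun x => Complex.exp (↑(-2 * Real.pi * x * freq a n) * Complex.I) * f x
  let v : ℝ → ℂ := fun y => Complex.exp (↑(-2 * Real.pi * y * starFreq a n) * Complex.I) *
    W.indicator (fun _ => (1 : ℂ)) y
  have hu : Measurable u := by
    have : Continuous u := by fun_prop
    exact this.measurable
  have hv : Measurable v := by
    refine Measurable.mul ?_ (measurable_const.indicator hW)
    exact (by fun_prop : Continuous fun y : ℝ =>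
      Complex.exp (↑(-2 * Real.pi * y * starFreq a n) * Complex.I)).measurable
  have h1 : ∀ s, UnitAddTorus.mFourier (-n) (toTorus s) * statFun a W f s =
      u (latMap a s).1 * v (latMap a s).2 := fun s => by
    rw [mFourier_neg_toTorus ha]
    simp only [u, v, statFun]
    ring
  simp_rw [h1]
  rw [integral_mul_comp_latMap ha hu hv, Real.fourier_real_eq_integral_exp_smul,
    Real.fourier_real_eq_integral_exp_smul]
  rfl

/-- In the coordinates of `latMap` the integral splits: the physical factor is a value of `f * f^*`,
the internal factor is the window overlap. This matches the atoms of the autocorrelation. -/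
theorem integral_statFun_add_mul_conj (ha : 0 < a) (hW : MeasurableSet W) (hf : Continuous f)
    (m : Fin 2 → ℤ) :
    ∫ s, statFun a W f (s + intVec m) * conj (statFun a W f s) =
      (ENNReal.ofReal (2 * a) * overlap W (latPt a m).2).toReal • convStar f (latPt a m).1 := by
  let O : Set ℝ := W ∩ (fun h => h + (latPt a m).2) ⁻¹' W
  have hO : MeasurableSet O := hW.inter ((measurable_add_const _) hW)
  let u : ℝ → ℂ := fun x => f (x + (latPt a m).1) * conj (f x)
  let v : ℝ → ℂ := O.indicator fun _ => (1 : ℂ)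
  have hu : Measurable u := by
    have : Continuous u := by fun_prop
    exact this.measurable
  have hv : Measurable v := measurable_const.indicator hO
  have h1 : ∀ s, statFun a W f (s + intVec m) * conj (statFun a W f s) =
      u (latMap a s).1 * v (latMap a s).2 := fun s => by
    have h2 : W.indicator (fun _ => (1 : ℂ)) ((latMap a s).2 + (latPt a m).2) *
        conj (W.indicator (fun _ => (1 : ℂ)) (latMap a s).2) = v (latMap a s).2 := by
      simp only [v, O]
      by_cases h3 : (latMap a s).2 ∈ W <;> by_cases h4 : (latMap a s).2 + (latPt a m).2 ∈ W <;>
        simp [h3, h4]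
    simp only [← h2, u, statFun, latMap_add, Prod.fst_add, Prod.snd_add, map_mul]
    simp only [latPt]
    ring
  simp_rw [h1]
  rw [integral_mul_comp_latMap ha hu hv, convStar_eq, ENNReal.toReal_mul,
    ENNReal.toReal_ofReal (by positivity), integral_indicator_const _ hO]
  simp only [overlap, u, O, Measure.real, Complex.real_smul]
  push_cast
  ring

/-- The weight of the diffraction at the dual lattice point with index `n`. -/
def peak (a : ℝ) (W : Set ℝ) (n : Fin 2 → ℤ) : ℝ :=
  ‖((2 * a : ℝ) : ℂ) * 𝓕 (W.indicator fun _ => (1 : ℂ)) (starFreq a n)‖ ^ 2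

theorem overlap_ne_top (hb : Bornology.IsBounded W) (t : ℝ) : overlap W t ≠ ⊤ :=
  ne_top_of_le_ne_top hb.measure_lt_top.ne (measure_mono Set.inter_subset_left)

/-- Both sides compute the same `L²` norm of the periodization of `statFun`: the sum by Parseval,
the integral by unfolding. -/
theorem exists_hasSum_peak (ha : 0 < a) (h : IsCutProjectLattice (lattice a))
    (hW : MeasurableSet W) (hb : Bornology.IsBounded W) (hf : Continuous f)
    (hs : HasCompactSupport f) :
    ∃ S : ℝ, HasSum (fun n => peak a W n * ‖𝓕 f (freq a n)‖ ^ 2) S ∧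
      (S : ℂ) = ∫ x, convStar f x
        ∂autocorrelation (torusMeasure (lattice a) h) (process (lattice a) W) := by
  have hG := isTest_statFun ha hW hb hf hs
  refine ⟨_, hG.hasSum_sq_integral.congr_fun fun n => ?_, ?_⟩
  · rw [integral_mFourier_statFun ha hW hf, peak, ← mul_pow, ← norm_mul]
    congr 2
    ring
  · rw [hG.integral_sq_periodize, autocorrelation_process ha h hW, integral_sum_dirac fun m =>
      ENNReal.mul_ne_top ENNReal.ofReal_ne_top (overlap_ne_top hb _)]
    exact tsum_congr fun m => integral_statFun_add_mul_conj ha hW hf m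

theorem intensity_process (ha : 0 < a) (h : IsCutProjectLattice (lattice a))
    (hW : MeasurableSet W) :
    intensity (torusMeasure (lattice a) h) (process (lattice a) W) = 2 * a * volume.real W := by
  rw [intensity, Measure.real, firstMoment_apply ha h hW measurableSet_Ico]
  simp [Measure.real, ha.le]

/-- The peak at the origin is the squared intensity, so subtracting `i² dx` in the autocorrelation
deletes precisely this term. -/
theorem peak_zero_mul (hW : MeasurableSet W) :
    ((peak a W 0 * ‖𝓕 f (freq a 0)‖ ^ 2 : ℝ) : ℂ) =
      ((2 * a * volume.real W : ℝ) : ℂ) ^ 2 * ((∫ x, f x) * conj (∫ x, f x)) := by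
  have h1 : 𝓕 (W.indicator fun _ => (1 : ℂ)) (starFreq a 0) = (volume.real W : ℂ) := by
    rw [Real.fourier_real_eq_integral_exp_smul]
    simp [starFreq, integral_indicator_const _ hW]
  have h2 : 𝓕 f (freq a 0) = ∫ x, f x := by
    rw [Real.fourier_real_eq_integral_exp_smul]
    simp [freq]
  rw [peak, h1, h2, Complex.mul_conj, Complex.normSq_eq_norm_sq, ← Complex.ofReal_mul,
    Complex.norm_real, Real.norm_eq_abs, sq_abs]
  push_cast
  ring

/-- The pure point measure that is the centered diffraction of the cut-and-project process. -/
def bragg (a : ℝ) (W : Set ℝ) : Measure ℝ :=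
  Measure.sum fun n : Fin 2 → ℤ =>
    ENNReal.ofReal (if n = 0 then 0 else peak a W n) • Measure.dirac (freq a n)

theorem peak_nonneg (a : ℝ) (W : Set ℝ) (n : Fin 2 → ℤ) : 0 ≤ peak a W n := sq_nonneg _

theorem hasSum_bragg (ha : 0 < a) (h : IsCutProjectLattice (lattice a))
    (hW : MeasurableSet W) (hb : Bornology.IsBounded W) (hf : Continuous f)
    (hs : HasCompactSupport f) :
    ∃ S : ℝ, HasSum (fun n => (ENNReal.ofReal (if n = 0 then 0 else peak a W n)).toReal *
        ‖𝓕 f (freq a n)‖ ^ 2) S ∧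
      (S : ℂ) = centeredAutocorrelation (torusMeasure (lattice a) h) (process (lattice a) W)
        (convStar f) := by
  obtain ⟨S, hS, hS'⟩ := exists_hasSum_peak ha h hW hb hf hs
  refine ⟨_, (hasSum_ite_sub_hasSum hS 0).congr_fun fun n => ?_, ?_⟩
  · by_cases hn : n = 0
    · simp [hn]
    · simp [hn, ENNReal.toReal_ofReal (peak_nonneg a W n)]
  · rw [centeredAutocorrelation, ← hS', intensity_process ha h hW,
      integral_convStar (hf.integrable_of_hasCompactSupport hs), Complex.ofReal_sub,
      peak_zero_mul hW]

theorem integrable_bragg (ha : 0 < a) (h : IsCutProjectLattice (lattice a))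
    (hW : MeasurableSet W) (hb : Bornology.IsBounded W) (hf : Continuous f)
    (hs : HasCompactSupport f) : Integrable (fun ξ => ‖𝓕 f ξ‖ ^ 2) (bragg a W) := by
  obtain ⟨S, hS, -⟩ := hasSum_bragg ha h hW hb hf hs
  refine integrable_sum_dirac (fun n => ENNReal.ofReal_ne_top) (hS.summable.congr fun n => ?_)
  rw [norm_pow, norm_norm]

theorem integral_bragg (ha : 0 < a) (h : IsCutProjectLattice (lattice a))
    (hW : MeasurableSet W) (hb : Bornology.IsBounded W) (hf : Continuous f)
    (hs : HasCompactSupport f) :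
    ((∫ ξ, ‖𝓕 f ξ‖ ^ 2 ∂bragg a W : ℝ) : ℂ) =
      centeredAutocorrelation (torusMeasure (lattice a) h) (process (lattice a) W)
        (convStar f) := by
  obtain ⟨S, hS, hS'⟩ := hasSum_bragg ha h hW hb hf hs
  rw [← hS', bragg, integral_sum_dirac fun n => ENNReal.ofReal_ne_top]
  simp only [smul_eq_mul]
  rw [hS.tsum_eq]

end Diffraction

/-! ### Fourier transforms of positive definite measures -/

section FourierUniqueness

theorem continuous_fourier_of_integrable {f : ℝ → ℂ} (hf : Integrable f) : Continuous (𝓕 f) :=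
  VectorFourier.fourierIntegral_continuous Real.continuous_fourierChar
    (innerSL ℝ).continuous₂ hf

theorem exists_fourier_ne_zero (ξ : ℝ) :
    ∃ g : ℝ → ℂ, Continuous g ∧ HasCompactSupport g ∧ 𝓕 g ξ ≠ 0 := by
  -- A bump modulated to frequency `ξ`: its transform at `ξ` is the positive integral of the bump.
  let φ : ContDiffBump (0 : ℝ) := ⟨1, 2, one_pos, one_lt_two⟩
  have hφ : Continuous φ := φ.continuous
  refine ⟨fun t => Complex.exp (↑(2 * Real.pi * t * ξ) * Complex.I) * (φ t : ℂ), by fun_prop, ?_, ?_⟩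
  · exact (φ.hasCompactSupport.comp_left (g := Complex.ofReal) rfl).mul_left
  · rw [Real.fourier_real_eq_integral_exp_smul]
    have h1 : ∀ t : ℝ, Complex.exp (↑(-2 * Real.pi * t * ξ) * Complex.I) •
        (Complex.exp (↑(2 * Real.pi * t * ξ) * Complex.I) * (φ t : ℂ)) = (φ t : ℂ) := fun t => by
      rw [smul_eq_mul, ← mul_assoc, ← Complex.exp_add]
      have : (↑(-2 * Real.pi * t * ξ) * Complex.I + ↑(2 * Real.pi * t * ξ) * Complex.I : ℂ) = 0 := by
        push_cast; ring
      rw [this, Complex.exp_zero, one_mul]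
    simp_rw [h1]
    rw [integral_complex_ofReal]
    exact_mod_cast (φ.integral_pos (μ := volume)).ne'

/-- Around `ξ`, a test function with nonvanishing transform keeps `|𝓕 g|²` above half its value at
`ξ`, and Markov's inequality bounds the mass of that neighbourhood. -/
theorem isLocallyFiniteMeasure_of_integrable_fourier {σ : Measure ℝ}
    (h : ∀ f : ℝ → ℂ, Continuous f → HasCompactSupport f →
      Integrable (fun ξ => ‖𝓕 f ξ‖ ^ 2) σ) : IsLocallyFiniteMeasure σ := by
  refine ⟨fun ξ => ?_⟩
  obtain ⟨g, hg, hs, hne⟩ := exists_fourier_ne_zero ξ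
  have hc : Continuous fun x => ‖𝓕 g x‖ ^ 2 :=
    (continuous_fourier_of_integrable (hg.integrable_of_hasCompactSupport hs)).norm.pow 2
  have hpos : 0 < ‖𝓕 g ξ‖ ^ 2 := by positivity
  refine ⟨{x | ‖𝓕 g ξ‖ ^ 2 / 2 < ‖𝓕 g x‖ ^ 2},
    (isOpen_lt continuous_const hc).mem_nhds (by simp only [Set.mem_ofPred_eq]; linarith), ?_⟩
  refine (measure_mono fun x hx => ?_).trans_lt
    ((h g hg hs).measure_norm_ge_lt_top (half_pos hpos))
  simp only [Set.mem_ofPred_eq] at hx ⊢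
  rw [Real.norm_of_nonneg (by positivity)]
  exact hx.le

theorem fourier_add_mul_translate {g : ℝ → ℂ} (hg : Integrable g) (c : ℂ) (t ξ : ℝ) :
    𝓕 (fun x => g x + c * g (x - t)) ξ =
      𝓕 g ξ * (1 + c * Complex.exp (↑(-2 * Real.pi * t * ξ) * Complex.I)) := by
  have hb : ∀ {g : ℝ → ℂ}, Integrable g → Integrable fun v : ℝ =>
      Complex.exp (↑(-2 * Real.pi * v * ξ) * Complex.I) * g v := fun {g} hg =>
    hg.bdd_mul (c := 1) (by fun_prop : Continuous fun v : ℝ =>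
      Complex.exp (↑(-2 * Real.pi * v * ξ) * Complex.I)).aestronglyMeasurable
      (ae_of_all _ fun v => (Complex.norm_exp_ofReal_mul_I _).le)
  simp only [Real.fourier_real_eq_integral_exp_smul, smul_eq_mul, mul_add, mul_one]
  have h2 : Integrable fun v : ℝ =>
      Complex.exp (↑(-2 * Real.pi * v * ξ) * Complex.I) * (c * g (v - t)) :=
    hb ((hg.comp_sub_right t).const_mul c)
  rw [integral_add (hb hg) h2]
  congr 1
  rw [← integral_add_right_eq_self _ t, ← integral_mul_const]
  refine integral_congr_ae (ae_of_all _ fun v => ?_)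
  simp only [add_sub_cancel_right]
  have : Complex.exp (↑(-2 * Real.pi * (v + t) * ξ) * Complex.I) =
      Complex.exp (↑(-2 * Real.pi * v * ξ) * Complex.I) *
        Complex.exp (↑(-2 * Real.pi * t * ξ) * Complex.I) := by
    rw [← Complex.exp_add]
    congr 1
    push_cast
    ring
  rw [this]
  ring

theorem norm_one_add_sq {z : ℂ} (hz : ‖z‖ = 1) : ‖1 + z‖ ^ 2 = 2 + 2 * z.re := by
  have h1 : z.re * z.re + z.im * z.im = 1 := by
    rw [← Complex.normSq_apply, Complex.normSq_eq_norm_sq, hz, one_pow]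
  rw [← Complex.normSq_eq_norm_sq, Complex.normSq_apply]
  simp only [Complex.add_re, Complex.add_im, Complex.one_re, Complex.one_im]
  linarith

variable {η : (ℝ → ℂ) → ℂ} {σ τ : Measure ℝ}

theorem IsFourierTransform.integral_fourier_sq_eq (hσ : IsFourierTransform η σ)
    (hτ : IsFourierTransform η τ) {f : ℝ → ℂ} (hf : Continuous f) (hs : HasCompactSupport f) :
    ∫ ξ, ‖𝓕 f ξ‖ ^ 2 ∂σ = ∫ ξ, ‖𝓕 f ξ‖ ^ 2 ∂τ := by
  have := (hσ.integral_eq f hf hs).trans (hτ.integral_eq f hf hs).symm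
  exact_mod_cast this

theorem IsFourierTransform.integrable_mul_exp (hσ : IsFourierTransform η σ) {g : ℝ → ℂ}
    (hg : Continuous g) (hs : HasCompactSupport g) (t : ℝ) :
    Integrable (fun ξ => ((‖𝓕 g ξ‖ ^ 2 : ℝ) : ℂ) *
      Complex.exp (↑(-2 * Real.pi * t * ξ) * Complex.I)) σ :=
  (hσ.integrable g hg hs).ofReal.mul_bdd (c := 1) (by fun_prop : Continuous fun ξ : ℝ =>
      Complex.exp (↑(-2 * Real.pi * t * ξ) * Complex.I)).aestronglyMeasurable
      (ae_of_all _ fun v => (Complex.norm_exp_ofReal_mul_I _).le)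

/-- Polarization with translates: the cross term of `g + c g(· - t)` exposes the Fourier integral of
the finite measure `|𝓕 g|² σ` at `t`. -/
theorem IsFourierTransform.integral_fourier_sq_translate (hσ : IsFourierTransform η σ)
    {g : ℝ → ℂ} (hg : Continuous g) (hs : HasCompactSupport g) {c : ℂ} (hc : ‖c‖ = 1) (t : ℝ) :
    ∫ ξ, ‖𝓕 (fun x => g x + c * g (x - t)) ξ‖ ^ 2 ∂σ =
      2 * ∫ ξ, ‖𝓕 g ξ‖ ^ 2 ∂σ + 2 * (c * ∫ ξ, ((‖𝓕 g ξ‖ ^ 2 : ℝ) : ℂ) *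
        Complex.exp (↑(-2 * Real.pi * t * ξ) * Complex.I) ∂σ).re := by
  have hi := (hσ.integrable_mul_exp hg hs t).const_mul c
  have h1 : ∀ ξ, ‖𝓕 (fun x => g x + c * g (x - t)) ξ‖ ^ 2 = 2 * ‖𝓕 g ξ‖ ^ 2 +
      2 * (c * (((‖𝓕 g ξ‖ ^ 2 : ℝ) : ℂ) *
        Complex.exp (↑(-2 * Real.pi * t * ξ) * Complex.I))).re := fun ξ => by
    have h2 : ‖c * Complex.exp (↑(-2 * Real.pi * t * ξ) * Complex.I)‖ = 1 := by
      rw [norm_mul, Complex.norm_exp_ofReal_mul_I, hc, one_mul]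
    rw [fourier_add_mul_translate (hg.integrable_of_hasCompactSupport hs), norm_mul, mul_pow,
      norm_one_add_sq h2, mul_left_comm c, Complex.re_ofReal_mul]
    ring
  simp_rw [h1]
  have hi' : Integrable (fun ξ => 2 * (c * (((‖𝓕 g ξ‖ ^ 2 : ℝ) : ℂ) *
      Complex.exp (↑(-2 * Real.pi * t * ξ) * Complex.I))).re) σ := hi.re.const_mul 2
  rw [integral_add ((hσ.integrable g hg hs).const_mul 2) hi', integral_const_mul,
    integral_const_mul, ← integral_const_mul c]
  congr 2
  exact integral_re hi

theorem IsFourierTransform.integral_mul_exp_eq (hσ : IsFourierTransform η σ)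
    (hτ : IsFourierTransform η τ) {g : ℝ → ℂ} (hg : Continuous g) (hs : HasCompactSupport g)
    (t : ℝ) :
    ∫ ξ, ((‖𝓕 g ξ‖ ^ 2 : ℝ) : ℂ) * Complex.exp (↑(-2 * Real.pi * t * ξ) * Complex.I) ∂σ =
      ∫ ξ, ((‖𝓕 g ξ‖ ^ 2 : ℝ) : ℂ) * Complex.exp (↑(-2 * Real.pi * t * ξ) * Complex.I) ∂τ := by
  have key : ∀ c : ℂ, ‖c‖ = 1 →
      (c * ∫ ξ, ((‖𝓕 g ξ‖ ^ 2 : ℝ) : ℂ) *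
        Complex.exp (↑(-2 * Real.pi * t * ξ) * Complex.I) ∂σ).re =
      (c * ∫ ξ, ((‖𝓕 g ξ‖ ^ 2 : ℝ) : ℂ) *
        Complex.exp (↑(-2 * Real.pi * t * ξ) * Complex.I) ∂τ).re := by
    intro c hc
    have hcont : Continuous fun x => g x + c * g (x - t) := by fun_prop
    have hsupp : HasCompactSupport fun x => g x + c * g (x - t) :=
      hs.add (hs.comp_homeomorph (Homeomorph.subRight t)).mul_left
    have h1 := hσ.integral_fourier_sq_eq hτ hcont hsupp
    rw [hσ.integral_fourier_sq_translate hg hs hc, hτ.integral_fourier_sq_translate hg hs hc,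
      hσ.integral_fourier_sq_eq hτ hg hs] at h1
    linarith
  -- `c = 1` recovers the real part and `c = -i` the imaginary part.
  refine Complex.ext (by simpa using key 1 (by simp)) ?_
  simpa using key (-Complex.I) (by simp)

/-- The Fourier transform of a positive definite measure is determined on points. -/
theorem IsFourierTransform.measure_singleton_eq (hσ : IsFourierTransform η σ)
    (hτ : IsFourierTransform η τ) (ξ : ℝ) : σ {ξ} = τ {ξ} := by
  obtain ⟨g, hg, hs, hne⟩ := exists_fourier_ne_zero ξ
  have hm : Measurable fun x => ENNReal.ofReal (‖𝓕 g x‖ ^ 2) :=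
    ((continuous_fourier_of_integrable (hg.integrable_of_hasCompactSupport
      hs)).norm.pow 2).measurable.ennreal_ofReal
  have hfin : ∀ {ρ : Measure ℝ}, IsFourierTransform η ρ →
      IsFiniteMeasure (ρ.withDensity fun x => ENNReal.ofReal (‖𝓕 g x‖ ^ 2)) := fun hρ =>
    isFiniteMeasure_withDensity_ofReal (hρ.integrable g hg hs).2
  have := hfin hσ
  have := hfin hτ
  -- `charFun` uses the kernel `e^{itx}`, whence the translation parameter `-t / (2π)`.
  have hchar : ∀ {ρ : Measure ℝ} (t : ℝ),
      charFun (ρ.withDensity fun x => ENNReal.ofReal (‖𝓕 g x‖ ^ 2)) t =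
        ∫ x, ((‖𝓕 g x‖ ^ 2 : ℝ) : ℂ) *
          Complex.exp (↑(-2 * Real.pi * (-t / (2 * Real.pi)) * x) * Complex.I) ∂ρ := by
    intro ρ t
    rw [charFun_apply_real, integral_withDensity_eq_integral_toReal_smul hm
      (ae_of_all _ fun _ => ENNReal.ofReal_lt_top)]
    refine integral_congr_ae (ae_of_all _ fun x => ?_)
    simp only [ENNReal.toReal_ofReal (sq_nonneg ‖𝓕 g x‖), Complex.real_smul]
    congr 3
    have : (Real.pi : ℂ) ≠ 0 := by exact_mod_cast Real.pi_ne_zero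
    push_cast
    field_simp
  have heq : σ.withDensity (fun x => ENNReal.ofReal (‖𝓕 g x‖ ^ 2)) =
      τ.withDensity fun x => ENNReal.ofReal (‖𝓕 g x‖ ^ 2) :=
    Measure.ext_of_charFun <| funext fun t => by
      rw [hchar, hchar, hσ.integral_mul_exp_eq hτ hg hs]
  -- The weighted measures coincide; dividing by the nonzero density at `ξ` compares the original
  -- masses.
  have h1 := congrArg (fun μ : Measure ℝ => μ {ξ}) heq
  simp only [withDensity_apply _ (measurableSet_singleton ξ), lintegral_singleton] at h1
  have h2 : ENNReal.ofReal (‖𝓕 g ξ‖ ^ 2) ≠ 0 := by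
    rw [ne_eq, ENNReal.ofReal_eq_zero, not_le]
    positivity
  exact (ENNReal.mul_right_inj h2 ENNReal.ofReal_ne_top).1 h1

end FourierUniqueness

/-! ### Lower bounds for the diffraction of `Γ_a` -/

section LowerBound

variable {a b : ℝ} {W : Set ℝ}

theorem isFourierTransform_bragg (ha : 0 < a) (h : IsCutProjectLattice (lattice a))
    (hW : MeasurableSet W) (hb : Bornology.IsBounded W) :
    IsFourierTransform
      (centeredAutocorrelation (torusMeasure (lattice a) h) (process (lattice a) W))
      (bragg a W) where
  locallyFinite := isLocallyFiniteMeasure_of_integrable_fourier fun _ hf hs =>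
    integrable_bragg ha h hW hb hf hs
  integrable _ hf hs := integrable_bragg ha h hW hb hf hs
  integral_eq _ hf hs := integral_bragg ha h hW hb hf hs

theorem isFourierTransform_diffraction (ha : 0 < a) (h : IsCutProjectLattice (lattice a))
    (hW : MeasurableSet W) (hb : Bornology.IsBounded W) :
    IsFourierTransform
      (centeredAutocorrelation (torusMeasure (lattice a) h) (process (lattice a) W))
      (diffraction (lattice a) h W) := by
  have hex : ∃ σ : Measure ℝ, IsFourierTransform
      (centeredAutocorrelation (torusMeasure (lattice a) h) (process (lattice a) W)) σ :=
    ⟨_, isFourierTransform_bragg ha h hW hb⟩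
  rw [diffraction, centeredDiffraction, dif_pos hex]
  exact hex.choose_spec

theorem ofReal_peak_le_diffraction (ha : 0 < a) (h : IsCutProjectLattice (lattice a))
    (hW : MeasurableSet W) (hb : Bornology.IsBounded W) {n : Fin 2 → ℤ} (hn : n ≠ 0) :
    ENNReal.ofReal (peak a W n) ≤ diffraction (lattice a) h W {freq a n} := by
  rw [(isFourierTransform_diffraction ha h hW hb).measure_singleton_eq
    (isFourierTransform_bragg ha h hW hb), bragg,
    Measure.sum_apply _ (measurableSet_singleton _)]
  -- A lower bound needs only the term of index `n`; all others are nonnegative.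
  refine le_trans ?_ (ENNReal.le_tsum n)
  simp [hn]

theorem fourier_indicator_Icc (hb : 0 ≤ b) {τ : ℝ} (hτ : τ ≠ 0) :
    𝓕 ((Set.Icc (-b) b).indicator fun _ => (1 : ℂ)) τ =
      ((Real.sin (2 * Real.pi * b * τ) / (Real.pi * τ) : ℝ) : ℂ) := by
  have hpi : (Real.pi : ℂ) ≠ 0 := by exact_mod_cast Real.pi_ne_zero
  have hτ' : (τ : ℂ) ≠ 0 := by exact_mod_cast hτ
  have hc : -(2 * Real.pi * τ * Complex.I) ≠ 0 := by simp [hτ]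
  have h1 : ∀ v : ℝ, Complex.exp (↑(-2 * Real.pi * v * τ) * Complex.I) •
      (Set.Icc (-b) b).indicator (fun _ => (1 : ℂ)) v =
      (Set.Icc (-b) b).indicator
        (fun v : ℝ => Complex.exp (-(2 * Real.pi * τ * Complex.I) * v)) v := fun v => by
    by_cases hv : v ∈ Set.Icc (-b) b
    · simp only [Set.indicator_of_mem hv, smul_eq_mul, mul_one]
      congr 1
      push_cast
      ring
    · simp only [Set.indicator_of_notMem hv, smul_zero]
  rw [Real.fourier_real_eq_integral_exp_smul]
  simp_rw [h1]
  rw [integral_indicator measurableSet_Icc, integral_Icc_eq_integral_Ioc,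
    ← intervalIntegral.integral_of_le (by linarith), integral_exp_mul_complex hc]
  push_cast
  rw [Complex.sin]
  have e1 : -(2 * Real.pi * τ * Complex.I) * (b : ℂ) = -(2 * Real.pi * b * τ : ℂ) * Complex.I := by
    ring
  have e2 : -(2 * Real.pi * τ * Complex.I) * (-b : ℂ) = (2 * Real.pi * b * τ : ℂ) * Complex.I := by
    ring
  rw [e1, e2]
  field_simp
  rw [Complex.I_sq]
  ring

theorem peak_Icc (hb : 0 ≤ b) {n : Fin 2 → ℤ} (hn : starFreq a n ≠ 0) :
    peak a (Set.Icc (-b) b) n =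
      (2 * a / (Real.pi * starFreq a n)) ^ 2 * Real.sin (2 * Real.pi * b * starFreq a n) ^ 2 := by
  rw [peak, fourier_indicator_Icc hb hn, ← Complex.ofReal_mul, Complex.norm_real, Real.norm_eq_abs,
    sq_abs, ← mul_pow]
  congr 1
  ring

/-- Let `A` be the set of exceptional `b`. The integrals of `sin²` over `A` tend to `0` by dominated
convergence. Writing `sin²` as half of one minus a cosine of doubled frequency, they tend to `|A| /
2` by Riemann–Lebesgue. Hence `A` is null. -/
theorem ae_not_tendsto_sin_sq {τ : ℕ → ℝ} (hτ : Tendsto τ atTop atTop) {S : Set ℝ}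
    (hS : MeasurableSet S) (hS' : volume S ≠ ⊤) :
    ∀ᵐ b ∂volume.restrict S,
      ¬ Tendsto (fun k => Real.sin (2 * Real.pi * b * τ k) ^ 2) atTop (𝓝 0) := by
  have hmeas : ∀ k, Measurable fun b => Real.sin (2 * Real.pi * b * τ k) ^ 2 := fun k => by fun_prop
  let A : Set ℝ := S ∩ {b | Tendsto (fun k => Real.sin (2 * Real.pi * b * τ k) ^ 2) atTop (𝓝 0)}
  have hB : MeasurableSet {b | Tendsto (fun k => Real.sin (2 * Real.pi * b * τ k) ^ 2) atTop (𝓝 0)} :=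
    measurableSet_tendsto (𝓝 0) hmeas
  have hA : MeasurableSet A := hS.inter hB
  have hAfin : volume A ≠ ⊤ := ne_top_of_le_ne_top hS' (measure_mono Set.inter_subset_left)
  have : IsFiniteMeasure (volume.restrict A) := ⟨by simpa using hAfin.lt_top⟩
  have h0 : Tendsto (fun k => ∫ b in A, Real.sin (2 * Real.pi * b * τ k) ^ 2) atTop (𝓝 0) := by
    have := tendsto_integral_of_dominated_convergence (μ := volume.restrict A) (f := fun _ => 0)
      (F := fun k b => Real.sin (2 * Real.pi * b * τ k) ^ 2) (fun _ => (1 : ℝ))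
      (fun k => (hmeas k).aestronglyMeasurable) (integrable_const _)
      (fun k => ae_of_all _ fun b => by
        rw [Real.norm_of_nonneg (sq_nonneg _)]; exact Real.sin_sq_le_one _)
      ((ae_restrict_mem hA).mono fun b hb => hb.2)
    simpa using this
  have h1 : Tendsto (fun k => (𝓕 (A.indicator fun _ => (1 : ℂ)) (2 * τ k)).re) atTop (𝓝 0) := by
    have h2 : Tendsto (fun k => 2 * τ k) atTop (cocompact ℝ) :=
      (hτ.const_mul_atTop two_pos).mono_right atTop_le_cocompact
    exact (Complex.continuous_re.tendsto 0).comp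
      ((Real.zero_at_infty_fourier (A.indicator fun _ => (1 : ℂ))).comp h2)
  have h2 : ∀ k, ∫ b in A, Real.sin (2 * Real.pi * b * τ k) ^ 2 =
      volume.real A / 2 - (𝓕 (A.indicator fun _ => (1 : ℂ)) (2 * τ k)).re / 2 := by
    intro k
    have hexp : Continuous fun v : ℝ =>
        Complex.exp (↑(-2 * Real.pi * v * (2 * τ k)) * Complex.I) := by fun_prop
    have h3 : 𝓕 (A.indicator fun _ => (1 : ℂ)) (2 * τ k) =
        ∫ v in A, Complex.exp (↑(-2 * Real.pi * v * (2 * τ k)) * Complex.I) := by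
      rw [Real.fourier_real_eq_integral_exp_smul, ← integral_indicator hA]
      refine integral_congr_ae (ae_of_all _ fun v => ?_)
      by_cases hv : v ∈ A <;> simp [hv]
    have hexpi : Integrable (fun v : ℝ =>
        Complex.exp (↑(-2 * Real.pi * v * (2 * τ k)) * Complex.I)) (volume.restrict A) :=
      Integrable.of_bound hexp.aestronglyMeasurable 1
        (ae_of_all _ fun v => (Complex.norm_exp_ofReal_mul_I _).le)
    have h4 : (∫ v in A, Complex.exp (↑(-2 * Real.pi * v * (2 * τ k)) * Complex.I)).re =
        ∫ v in A, (Complex.exp (↑(-2 * Real.pi * v * (2 * τ k)) * Complex.I)).re :=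
      (integral_re hexpi).symm
    have hexpi' : Integrable (fun v : ℝ =>
        (Complex.exp (↑(-2 * Real.pi * v * (2 * τ k)) * Complex.I)).re) (volume.restrict A) := hexpi.re
    have h5 : ∀ v : ℝ, Real.sin (2 * Real.pi * v * τ k) ^ 2 =
        1 / 2 - (Complex.exp (↑(-2 * Real.pi * v * (2 * τ k)) * Complex.I)).re / 2 := fun v => by
      rw [Complex.exp_ofReal_mul_I_re, Real.sin_sq_eq_half_sub]
      have : -2 * Real.pi * v * (2 * τ k) = -(2 * (2 * Real.pi * v * τ k)) := by ring
      rw [this, Real.cos_neg]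
    simp_rw [h5]
    rw [integral_sub (integrable_const _) (hexpi'.div_const 2), setIntegral_const, smul_eq_mul,
      integral_div, h3, h4]
    ring
  have h3 : Tendsto (fun k => ∫ b in A, Real.sin (2 * Real.pi * b * τ k) ^ 2) atTop
      (𝓝 (volume.real A / 2)) := by
    simp_rw [h2]
    simpa using tendsto_const_nhds.sub (h1.div_const 2)
  have h4 : volume.real A = 0 := by linarith [tendsto_nhds_unique h0 h3]
  have h5 : volume A = 0 := (measureReal_eq_zero_iff hAfin).1 h4
  rw [ae_restrict_iff' hS, ae_iff]
  refine measure_mono_null (fun b hb => ?_) h5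
  simp only [Set.mem_ofPred_eq, not_forall, not_not] at hb
  exact ⟨hb.1, hb.2⟩

/-- The index of the dual lattice point closest to `(0, 2 a m)`. -/
def approxIndex (a : ℝ) (m : ℕ) : Fin 2 → ℤ := ![m, round (m * a)]

theorem abs_freq_approxIndex (a : ℝ) (m : ℕ) : |freq a (approxIndex a m)| = distInt (m * a) := by
  rw [distInt_eq]
  simp [freq, approxIndex, mul_comm]

/-- The rounded term is nonnegative and at most `m a + 1/2`, and `1/2` is absorbed into `m` because
`m ≥ 1`. -/
theorem starFreq_approxIndex_bounds (ha : 0 < a) {m : ℕ} (hm : 0 < m) :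
    a * m ≤ starFreq a (approxIndex a m) ∧ starFreq a (approxIndex a m) ≤ (2 * a + 1) * m := by
  have hm' : (1 : ℝ) ≤ m := by exact_mod_cast hm
  have h0 : 0 < m * a := by positivity
  have h1 : starFreq a (approxIndex a m) = a * m + round (m * a) := by
    simp [starFreq, approxIndex]
  have h2 := abs_le.1 (abs_sub_round (m * a))
  have h3 : (0 : ℤ) ≤ round (m * a) := by
    rw [round_eq]
    exact Int.floor_nonneg.2 (by linarith)
  have h4 : (0 : ℝ) ≤ round (m * a) := by exact_mod_cast h3
  rw [h1]
  constructor <;> nlinarith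

/-- For almost every `b`, the diffraction has atoms of weight at least `c / m²` at distance at most
`{m a}` of the origin, for infinitely many members `m` of a given sequence. -/
theorem ae_exists_subseq_atom_ge (ha : 0 < a) (h : IsCutProjectLattice (lattice a))
    {m : ℕ → ℕ} (hm : ∀ k, 0 < m k) (hlim : Tendsto m atTop atTop) :
    ∀ᵐ b ∂volume.restrict (Set.Ioc 0 (1 / (2 * a))),
      ∃ k : ℕ → ℕ, StrictMono k ∧ ∃ c : ℝ, 0 < c ∧ ∀ j, ∃ ξ : ℝ,
        |ξ| = distInt (m (k j) * a) ∧
        ENNReal.ofReal (c * (m (k j) : ℝ) ^ (-2 : ℝ)) ≤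
          diffraction (lattice a) h (Set.Icc (-b) b) {ξ} := by
  let τ : ℕ → ℝ := fun k => starFreq a (approxIndex a (m k))
  have hτ : Tendsto τ atTop atTop :=
    tendsto_atTop_mono (fun k => (starFreq_approxIndex_bounds ha (hm k)).1)
      ((tendsto_natCast_atTop_atTop.comp hlim).const_mul_atTop ha)
  filter_upwards [ae_not_tendsto_sin_sq hτ (measurableSet_Ioc (a := (0 : ℝ)) (b := 1 / (2 * a)))
    (by simp), ae_restrict_mem measurableSet_Ioc] with b hb hb'
  rw [Metric.tendsto_atTop] at hb
  push Not at hb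
  obtain ⟨ε, hε, hfreq⟩ := hb
  obtain ⟨k, hk, hk'⟩ := extraction_of_frequently_atTop (frequently_atTop.2 hfreq)
  -- The constant combines `sin² ≥ ε` along the subsequence with the upper bound `τ ≤ (2a + 1) m` in
  -- the denominator of the peak.
  refine ⟨k, hk, (2 * a / (Real.pi * (2 * a + 1))) ^ 2 * ε, by positivity, fun j =>
    ⟨freq a (approxIndex a (m (k j))), abs_freq_approxIndex a _, ?_⟩⟩
  have hmj : (0 : ℝ) < m (k j) := by exact_mod_cast hm (k j)
  obtain ⟨h1, h2⟩ := starFreq_approxIndex_bounds ha (hm (k j))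
  have h3 : 0 < starFreq a (approxIndex a (m (k j))) := lt_of_lt_of_le (by positivity) h1
  have hn : approxIndex a (m (k j)) ≠ 0 := fun h0 => by
    rw [h0] at h3
    simp [starFreq] at h3
  refine le_trans (ENNReal.ofReal_le_ofReal ?_)
    (ofReal_peak_le_diffraction ha h measurableSet_Icc (Metric.isBounded_Icc _ _) hn)
  rw [peak_Icc hb'.1.le h3.ne']
  have h4 := hk' j
  rw [Real.dist_0_eq_abs, abs_of_nonneg (sq_nonneg _)] at h4
  have h5 : (2 * a / (Real.pi * (2 * a + 1))) ^ 2 * ε * (m (k j) : ℝ) ^ (-2 : ℝ) =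
      (2 * a / (Real.pi * ((2 * a + 1) * m (k j)))) ^ 2 * ε := by
    rw [Real.rpow_neg hmj.le, Real.rpow_two]
    field_simp
  rw [h5]
  gcongr

end LowerBound

/-! ### Atoms near the origin and power decay -/

section Decay

/-- The ratio is a positive constant times `m^(γδ - 2)`, whose exponent is positive exactly when `δ
> 2/γ`. -/
theorem tendsto_ratio_atTop {m : ℕ → ℕ} (hm : ∀ k, 0 < m k) (hlim : Tendsto m atTop atTop)
    {c γ δ : ℝ} (hc : 0 < c) (hγ : 0 < γ) (hδ : 2 / γ < δ) :
    Tendsto (fun k => c * (m k : ℝ) ^ (-2 : ℝ) / (2 * (m k : ℝ) ^ (-γ)) ^ δ) atTop atTop := by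
  have h1 : 0 < γ * δ - 2 := by
    rw [div_lt_iff₀ hγ] at hδ
    linarith
  have h2 : Tendsto (fun k => c / 2 ^ δ * (m k : ℝ) ^ (γ * δ - 2)) atTop atTop :=
    ((tendsto_rpow_atTop h1).comp (tendsto_natCast_atTop_atTop.comp hlim)).const_mul_atTop
      (by positivity)
  refine h2.congr fun k => ?_
  have hk : (0 : ℝ) < m k := by exact_mod_cast hm k
  rw [Real.mul_rpow two_pos.le (by positivity), ← Real.rpow_mul hk.le,
    show γ * δ - 2 = -2 - -γ * δ by ring, Real.rpow_sub hk]
  field_simp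

theorem tendsto_scale {m : ℕ → ℕ} (hm : ∀ k, 0 < m k) (hlim : Tendsto m atTop atTop) {γ : ℝ}
    (hγ : 0 < γ) : Tendsto (fun k => 2 * (m k : ℝ) ^ (-γ)) atTop (𝓝[>] 0) := by
  refine tendsto_nhdsWithin_iff.2 ⟨?_, Eventually.of_forall fun k => ?_⟩
  · simpa using ((tendsto_rpow_neg_atTop hγ).comp
      (tendsto_natCast_atTop_atTop.comp hlim)).const_mul 2
  · have hk : (0 : ℝ) < m k := by exact_mod_cast hm k
    exact Set.mem_Ioi.2 (by positivity)

theorem limsup_eq_top_of_frequently {μ : Measure ℝ} {δ : ℝ} {s : ℝ → Set ℝ}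
    (h : ∀ C : ℝ, ∃ᶠ u in 𝓝[>] (0 : ℝ), ENNReal.ofReal (C * u ^ δ) ≤ μ (s u)) :
    limsup (fun u : ℝ => μ (s u) / ENNReal.ofReal (u ^ δ)) (𝓝[>] 0) = ⊤ := by
  refine ENNReal.eq_top_of_forall_nnreal_le fun C => le_limsup_of_frequently_le ?_
  refine ((h C).and_eventually self_mem_nhdsWithin).mono fun u hu => ?_
  have hpos : 0 < u ^ δ := Real.rpow_pos_of_pos hu.2 δ
  rw [ENNReal.le_div_iff_mul_le (Or.inl (by simpa using hpos)) (Or.inl ENNReal.ofReal_ne_top)]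
  refine le_trans (le_of_eq ?_) hu.1
  rw [ENNReal.ofReal_mul C.coe_nonneg, ENNReal.ofReal_coe_nnreal]

theorem exists_seq_distInt_le {a : ℝ} (hL : Liouville a) (r : ℕ) :
    ∃ m : ℕ → ℕ, (∀ k, 0 < m k) ∧ Tendsto m atTop atTop ∧
      ∀ k, distInt (m k * a) ≤ (m k : ℝ) ^ (-(r : ℝ)) := by
  -- Exponent `r + 1` is used because passing from `|a - p/m|` to `|m a - p|` costs one factor `m`.
  obtain ⟨m, hm, hm'⟩ := extraction_of_frequently_atTop
    ((hL.frequently_exists_num (r + 1)).and_eventually (eventually_gt_atTop 0))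
  refine ⟨m, fun k => (hm' k).2, hm.tendsto_atTop, fun k => ?_⟩
  obtain ⟨⟨p, -, hp⟩, hpos⟩ := hm' k
  have hk : (0 : ℝ) < m k := by exact_mod_cast hpos
  calc distInt (m k * a) ≤ |m k * a - p| := by
        rw [distInt_eq]
        exact round_le _ _
    _ = m k * |a - p / m k| := by
        conv_rhs => rw [← abs_of_pos hk, ← abs_mul]
        rw [abs_of_pos hk]
        congr 1
        field_simp
    _ ≤ m k * (1 / (m k : ℝ) ^ (r + 1)) := by gcongr
    _ = (m k : ℝ) ^ (-(r : ℝ)) := by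
        rw [Real.rpow_neg hk.le, Real.rpow_natCast, pow_succ]
        field_simp

variable {a : ℝ}

theorem ae_exists_subseq_tendsto (ha : 0 < a) (h : IsCutProjectLattice (lattice a)) {γ : ℝ}
    (hγ : 0 < γ) {m : ℕ → ℕ} (hm : ∀ k, 0 < m k) (hlim : Tendsto m atTop atTop)
    (hd : ∀ k, distInt (m k * a) ≤ (m k : ℝ) ^ (-γ)) :
    ∀ᵐ b ∂(volume.restrict (Set.Ioc 0 (1 / (2 * a)))),
      ∃ k : ℕ → ℕ, StrictMono k ∧ ∀ δ : ℝ, 2 / γ < δ →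
        Tendsto (fun j : ℕ =>
          (diffraction (lattice a) h (Set.Icc (-b) b)).real
            (Set.Icc (-(2 * (m (k j) : ℝ) ^ (-γ))) (2 * (m (k j) : ℝ) ^ (-γ))) /
          (2 * (m (k j) : ℝ) ^ (-γ)) ^ δ) atTop atTop := by
  filter_upwards [ae_exists_subseq_atom_ge ha h hm hlim] with b ⟨k, hk, c, hc, hatom⟩
  refine ⟨k, hk, fun δ hδ => ?_⟩
  refine tendsto_atTop_mono (fun j => ?_) (tendsto_ratio_atTop (fun j => hm (k j))
    (hlim.comp hk.tendsto_atTop) hc hγ hδ)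
  have hj : (0 : ℝ) < m (k j) := by exact_mod_cast hm (k j)
  -- Local finiteness makes the mass of the interval finite, so that `.real` is its true value and
  -- not the default `0`.
  have := (isFourierTransform_diffraction ha h (measurableSet_Icc (a := -b) (b := b))
    (Metric.isBounded_Icc _ _)).locallyFinite
  obtain ⟨ξ, hξ, hle⟩ := hatom j
  have hpos : 0 < (m (k j) : ℝ) ^ (-γ) := by positivity
  gcongr
  refine (ENNReal.ofReal_le_iff_le_toReal isCompact_Icc.measure_lt_top.ne).1
    (hle.trans (measure_mono (Set.singleton_subset_iff.2 ?_)))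
  exact abs_le.1 (hξ.le.trans ((hd (k j)).trans (by linarith)))

theorem ae_frequently_measure_ball_ge (ha : 0 < a) (hL : Liouville a)
    (h : IsCutProjectLattice (lattice a)) :
    ∀ᵐ b ∂(volume.restrict (Set.Ioc 0 (1 / (2 * a)))), ∀ δ : ℝ, 0 < δ → ∀ C : ℝ,
      ∃ᶠ u in 𝓝[>] (0 : ℝ), ENNReal.ofReal (C * u ^ δ) ≤
        diffraction (lattice a) h (Set.Icc (-b) b) (Metric.ball 0 u) := by
  choose m hm hlim hd using exists_seq_distInt_le hL
  -- The exceptional null set depends on the approximation exponent. Restricting to natural `r`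
  -- leaves countably many, so one full-measure set of `b` serves all `δ` and `C`.
  filter_upwards [ae_all_iff.2 fun r => ae_exists_subseq_atom_ge ha h (hm r) (hlim r)]
    with b hb δ hδ C
  obtain ⟨r, hr⟩ := exists_nat_gt (2 / δ)
  have hr0 : (0 : ℝ) < r := lt_trans (by positivity) hr
  have hr' : 2 / (r : ℝ) < δ := by
    rw [div_lt_iff₀ hδ] at hr
    rw [div_lt_iff₀ hr0]
    linarith
  obtain ⟨k, hk, c, hc, hatom⟩ := hb r
  have hlim' := (hlim r).comp hk.tendsto_atTop
  have hpos : ∀ j, 0 < (m r ∘ k) j := fun j => hm r (k j)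
  refine (tendsto_scale hpos hlim' hr0).frequently (Eventually.frequently ?_)
  filter_upwards [(tendsto_ratio_atTop hpos hlim' hc hr0 hr').eventually_ge_atTop C] with j hj
  obtain ⟨ξ, hξ, hle⟩ := hatom j
  have hj0 : (0 : ℝ) < m r (k j) := by exact_mod_cast hm r (k j)
  have hp : 0 < (m r (k j) : ℝ) ^ (-(r : ℝ)) := by positivity
  rw [le_div_iff₀ (by simp only [Function.comp_apply]; positivity)] at hj
  refine ((ENNReal.ofReal_le_ofReal hj).trans hle).trans
    (measure_mono (Set.singleton_subset_iff.2 ?_))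
  rw [mem_ball_zero_iff, Real.norm_eq_abs, hξ]
  -- The factor `2` in the radius gives the strict inequality needed for the open ball.
  refine (hd r (k j)).trans_lt ?_
  simp only [Function.comp_apply]
  linarith

theorem ae_limsup_Icc_eq_top (ha : 0 < a) (hL : Liouville a)
    (h : IsCutProjectLattice (lattice a)) :
    ∀ᵐ b ∂(volume.restrict (Set.Ioc 0 (1 / (2 * a)))), ∀ δ : ℝ, 0 < δ →
      limsup (fun u : ℝ => diffraction (lattice a) h (Set.Icc (-b) b) (Set.Icc (-u) u) /
        ENNReal.ofReal (u ^ δ)) (𝓝[>] 0) = ⊤ := by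
  filter_upwards [ae_frequently_measure_ball_ge ha hL h] with b hb δ hδ
  refine limsup_eq_top_of_frequently fun C => (hb δ hδ C).mono fun u hu =>
    hu.trans (measure_mono ?_)
  rw [Real.ball_eq_Ioo, zero_sub, zero_add]
  exact Set.Ioo_subset_Icc_self

/-- Liouville's constant in base `2` with a generic symmetric window works for all exponents at
once. -/
theorem exists_limsup_ball_eq_top :
    ∃ (Γ : AddSubgroup (ℝ × ℝ)) (hΓ : IsCutProjectLattice Γ) (c d : ℝ), c < d ∧
      ∀ α : ℝ, 0 < α →
        limsup (fun ε : ℝ => diffraction Γ hΓ (Set.Icc c d) (Metric.ball 0 ε) /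
          ENNReal.ofReal (ε ^ α)) (𝓝[>] 0) = ⊤ := by
  have hL : Liouville (liouvilleNumber 2) := by
    exact_mod_cast liouville_liouvilleNumber le_rfl
  have ha : 0 < liouvilleNumber 2 := by
    rw [← LiouvilleNumber.partialSum_add_remainder one_lt_two 0]
    exact add_pos_of_nonneg_of_pos (Finset.sum_nonneg fun _ _ => by positivity)
      (LiouvilleNumber.remainder_pos one_lt_two 0)
  have hΓ := isCutProjectLattice ha hL.irrational
  -- The parameter interval has positive length, so an almost sure property holds for some `b` in
  -- it.
  have : NeBot (ae (volume.restrict (Set.Ioc 0 (1 / (2 * liouvilleNumber 2))))) := by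
    rw [ae_neBot, ne_eq, Measure.restrict_eq_zero, Real.volume_Ioc, ENNReal.ofReal_eq_zero, not_le]
    simpa using ha
  obtain ⟨b, hb, hb'⟩ := ((ae_frequently_measure_ball_ge ha hL hΓ).and
    (ae_restrict_mem measurableSet_Ioc)).exists
  exact ⟨_, hΓ, -b, b, by linarith [hb'.1], fun α hα => limsup_eq_top_of_frequently (hb α hα)⟩

/-- Hyperuniformity would force the limsup with exponent `1` to be `0`. -/
theorem not_isHyperuniform_of_limsup {Ω : Type*} [MeasurableSpace Ω] {P : Measure Ω}
    {p : Ω → Measure ℝ}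
    (h : limsup (fun ε : ℝ => centeredDiffraction P p (Metric.ball 0 ε) /
      ENNReal.ofReal (ε ^ (1 : ℝ))) (𝓝[>] 0) = ⊤) : ¬ IsHyperuniform P p := by
  intro hp
  simp only [Real.rpow_one] at h
  rw [Tendsto.limsup_eq hp] at h
  exact ENNReal.zero_ne_top h

end Decay

end CutProject

end
-- Assembly of the four statements.
open CutProject in
theorem mainTheorem2 :
    -- lower bound for a well-approximable parameter `a`
    (∀ (a : ℝ) (ha : 0 < a) (hirr : Irrational a) (γ : ℝ), 2 < γ →
      ∀ m : ℕ → ℕ, (∀ k, 0 < m k) → Tendsto m atTop atTop →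
      (∀ k, distInt (m k * a) ≤ (m k : ℝ) ^ (-γ)) →
      ∀ᵐ b ∂(volume.restrict (Set.Ioc 0 (1 / (2 * a)))),
        ∃ k : ℕ → ℕ, StrictMono k ∧ ∀ δ : ℝ, 2 / γ < δ →
          Tendsto (fun j : ℕ =>
            (diffraction (lattice a) (isCutProjectLattice ha hirr) (Set.Icc (-b) b)).real
              (Set.Icc (-(2 * (m (k j) : ℝ) ^ (-γ))) (2 * (m (k j) : ℝ) ^ (-γ))) /
            (2 * (m (k j) : ℝ) ^ (-γ)) ^ δ) atTop atTop) ∧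
    -- Liouville parameters `a`
    (∀ (a : ℝ) (ha : 0 < a) (hL : Liouville a),
      ∀ᵐ b ∂(volume.restrict (Set.Ioc 0 (1 / (2 * a)))), ∀ δ : ℝ, 0 < δ →
        limsup (fun u : ℝ =>
          diffraction (lattice a) (isCutProjectLattice ha hL.irrational) (Set.Icc (-b) b)
            (Set.Icc (-u) u) / ENNReal.ofReal (u ^ δ)) (𝓝[>] 0) = ⊤) ∧
    -- arbitrarily slow power decay for some cut-and-project process with an interval window
    (∀ α : ℝ, 0 < α →
      ∃ (Γ : AddSubgroup (ℝ × ℝ)) (hΓ : IsCutProjectLattice Γ) (c d : ℝ), c < d ∧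
        limsup (fun ε : ℝ => diffraction Γ hΓ (Set.Icc c d) (Metric.ball 0 ε) /
          ENNReal.ofReal (ε ^ α)) (𝓝[>] 0) = ⊤) ∧
    -- cut-and-project processes with interval windows need not be hyperuniform
    (∃ (Γ : AddSubgroup (ℝ × ℝ)) (hΓ : IsCutProjectLattice Γ) (c d : ℝ), c < d ∧
      ¬ IsHyperuniform (torusMeasure Γ hΓ) (process Γ (Set.Icc c d))) := by
  refine ⟨fun a ha hirr γ hγ m hm hlim hd => ae_exists_subseq_tendsto ha _ (by linarith) hm hlim hd,
    fun a ha hL => ae_limsup_Icc_eq_top ha hL _, fun α hα => ?_, ?_⟩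
  · obtain ⟨Γ, hΓ, c, d, hcd, h⟩ := exists_limsup_ball_eq_top
    exact ⟨Γ, hΓ, c, d, hcd, h α hα⟩
  · obtain ⟨Γ, hΓ, c, d, hcd, h⟩ := exists_limsup_ball_eq_top
    exact ⟨Γ, hΓ, c, d, hcd, not_isHyperuniform_of_limsup (h 1 one_pos)⟩
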